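/- Let $(A_N)_{N\ge 1}$ be random matrices defined on a common probability space, where $A_N=(a^{(N)}_{i,j})_{i,j\in[N]}$ is a real symmetric $N\times N$ matrix and, for each $N$, the entries $a^{(N)}_{i,j}$ with $i\le j$ are independent. Suppose that (a) $\mathbf E\,a^{(N)}_{i,j}=0$ and $s^{(N)}_{i,j}:=\mathbf E|a^{(N)}_{i,j}|^2\le 1$ for all $N\ge 1$ and $i,j\in[N]$, and $\sup_{N\ge 1,\ i,j\in[N]}\mathbf E|a^{(N)}_{i,j}|^4<\infty$; (b) $\lim_{N\to\infty}\sum_{i,j\in[N]}\mathbf P\big(|a^{(N)}_{i,j}|\ge\delta\sqrt N\big)=0$ for every $\delta>0$. For $k\ge 0$ let $\mathbf C_k$ be the (finite) set of ordered rooted trees with $k$ edges, up to isomorphism, and let $$M_N(k):=\sum_{T\in\mathbf C_k}\ \sum_{\ell}\ \prod_{\{u,v\}\in E(T)}s^{(N)}_{\ell(u),\ell(v)},$$ where $\ell$ runs over the injective maps from the vertex set of $T$ to $[N]$, and $E(T)$ is the edge set of $T$. Let $R>0$, and suppose that the following condition $\Sigma(R)$ holds: for each $C_1>0$ there are $C_2>0$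 and an integer $N_0\ge 1$ such that $$M_N(k)\le C_2\,N^{k+1}R^{2k}\qquad\text{for all integers } N\ge N_0 \text{ and } k \text{ with } 1\le k\le C_1\log N.$$ Then, for every $\varepsilon>0$, $$\lim_{N\to\infty}\mathbf P\left(\frac{|A_N|_{\mathrm{op}}}{\sqrt N}\ge R(1+\varepsilon)\right)=0,$$ where $|A|_{\mathrm{op}}=\max_{\|x\|_2=1}\|Ax\|_2$. -/

import Mathlib

open MeasureTheory ProbabilityTheory Filter Topology

/-- An ordered (plane) rooted tree, as the finite set of addresses of its vertices: the root is `[]`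
and `j :: u` is the child number `j` (counted from `0`) of the vertex `u`. Every isomorphism class
of ordered rooted trees is represented by exactly one such set. -/
@[ext]
structure PlaneTree where
  /-- The vertices. -/
  verts : Finset (List ℕ)
  root_mem : [] ∈ verts
  /-- The parent of a vertex is a vertex. -/
  tail_mem : ∀ (j : ℕ) (u : List ℕ), j :: u ∈ verts → u ∈ verts
  /-- The children of a vertex are numbered consecutively. -/
  pred_mem : ∀ (j : ℕ) (u : List ℕ), (j + 1) :: u ∈ verts → j :: u ∈ verts

namespace PlaneTree

/-- The root, as a vertex. -/
def root (T : PlaneTree) : T.verts := ⟨[], T.root_mem⟩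

theorem list_tail_mem (T : PlaneTree) (u : List ℕ) (hu : u ∈ T.verts) : u.tail ∈ T.verts := by
  cases u with
  | nil => exact hu
  | cons j u => exact T.tail_mem j u hu

/-- The parent of a vertex (of interest for vertices other than the root). -/
def parent (T : PlaneTree) (u : T.verts) : T.verts := ⟨u.1.tail, T.list_tail_mem u.1 u.2⟩

theorem append_mem (T : PlaneTree) (v u : List ℕ) (h : v ++ u ∈ T.verts) : u ∈ T.verts := by
  induction v with
  | nil => exact h
  | cons j v ih => exact ih (T.tail_mem j _ h)

theorem le_mem (T : PlaneTree) (u : List ℕ) (i j : ℕ) (hij : i ≤ j) (h : j :: u ∈ T.verts) :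
    i :: u ∈ T.verts := by
  induction j, hij using Nat.le_induction with
  | base => exact h
  | succ j _ ih => exact ih (T.pred_mem j u h)

theorem length_lt (T : PlaneTree) (u : List ℕ) (hu : u ∈ T.verts) : u.length < T.verts.card := by
  have h : (Finset.range (u.length + 1)).card ≤ T.verts.card := by
    refine Finset.card_le_card_of_injOn (fun n => u.drop n) ?_ ?_
    · intro n _
      exact T.append_mem (u.take n) (u.drop n) (by rw [List.take_append_drop]; exact hu)
    · intro a ha b hb hab
      have := congrArg List.length hab
      simp only [Finset.coe_range, Set.mem_Iio, List.length_drop] at ha hb this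
      omega
  simpa using h

theorem head_lt (T : PlaneTree) (j : ℕ) (u : List ℕ) (hu : j :: u ∈ T.verts) :
    j < T.verts.card := by
  have h : (Finset.range (j + 1)).card ≤ T.verts.card := by
    refine Finset.card_le_card_of_injOn (fun n => n :: u) ?_ ?_
    · intro n hn
      have hn' : n < j + 1 := by simpa using hn
      exact T.le_mem u n j (by omega) hu
    · intro a _ b _ hab
      exact (List.cons.inj hab).1
  simpa using h

theorem entries_lt (T : PlaneTree) (u : List ℕ) (hu : u ∈ T.verts) :
    ∀ a ∈ u, a < T.verts.card := by
  induction u with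
  | nil => simp
  | cons j u ih =>
    intro a ha
    rcases List.mem_cons.1 ha with rfl | ha
    · exact T.head_lt _ u hu
    · exact ih (T.tail_mem j u hu) a ha

theorem finite_lists (n : ℕ) : {u : List ℕ | u.length < n ∧ ∀ a ∈ u, a < n}.Finite := by
  refine ((List.finite_length_lt (Fin n) n).image (List.map Fin.val)).subset ?_
  rintro u ⟨hl, ha⟩
  refine ⟨u.pmap Fin.mk ha, by simpa using hl, ?_⟩
  simp [List.map_pmap]

/-- There are finitely many plane trees with `k` edges, that is, with `k + 1` vertices. -/
theorem finite_card_eq (k : ℕ) : {T : PlaneTree | T.verts.card = k + 1}.Finite := by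
  refine Set.Finite.of_finite_image
    (f := PlaneTree.verts)
    (((finite_lists (k + 1)).toFinset.powerset.finite_toSet).subset ?_) ?_
  · rintro _ ⟨T, hT, rfl⟩
    have hT' : T.verts.card = k + 1 := hT
    simp only [Finset.coe_powerset, Set.mem_preimage, Set.mem_powerset_iff]
    intro u hu
    have hu' : u ∈ T.verts := hu
    simp only [Set.Finite.coe_toFinset, Set.mem_ofPred_eq]
    exact ⟨hT' ▸ T.length_lt u hu', hT' ▸ T.entries_lt u hu'⟩
  · intro S _ T _ h
    exact PlaneTree.ext h

/-- The plane trees with `k` edges. -/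
noncomputable def withEdges (k : ℕ) : Finset PlaneTree := (finite_card_eq k).toFinset

end PlaneTree

section RandomMatrices

variable {Ω : Type*} [MeasurableSpace Ω]

/-- The operator norm of a square matrix with respect to the Euclidean norm. -/
noncomputable def opNorm {N : ℕ} (M : Matrix (Fin N) (Fin N) ℝ) : ℝ :=
  ‖Matrix.toEuclideanCLM (n := Fin N) (𝕜 := ℝ) M‖

/-- The variance profile `s_{i,j} = E |a_{i,j}|²`. -/
noncomputable def varProfile (P : Measure Ω) {N : ℕ} (A : Ω → Matrix (Fin N) (Fin N) ℝ)
    (i j : Fin N) : ℝ :=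
  ∫ ω, |A ω i j| ^ 2 ∂P

/-- `∑_T ∑_ℓ ∏_{edges of T} s`, over the plane trees `T` with `k` edges and the labelings `ℓ` of the
vertices of `T` by distinct elements of `Fin N`. An edge is given by its lower end `u`, a vertex
other than the root. -/
noncomputable def treeSum {N : ℕ} (s : Fin N → Fin N → ℝ) (k : ℕ) : ℝ :=
  ∑ T ∈ PlaneTree.withEdges k, ∑ l : T.verts ↪ Fin N,
    ∏ u : T.verts with u ≠ T.root, s (l (T.parent u)) (l u)

/-- A sequence of symmetric random matrices, `A N` of size `N × N`, each with independent entries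
up to symmetry. -/
structure IsSymmRandomMatrixSeq (P : Measure Ω) (A : (N : ℕ) → Ω → Matrix (Fin N) (Fin N) ℝ) :
    Prop where
  measurable : ∀ (N : ℕ) (i j : Fin N), Measurable fun ω => A N ω i j
  isSymm : ∀ (N : ℕ) (ω : Ω), (A N ω).IsSymm
  indep : ∀ N : ℕ,
    iIndepFun (fun (p : {p : Fin N × Fin N // p.1 ≤ p.2}) ω => A N ω p.1.1 p.1.2) P

/-- Centered entries, variances at most `1`, bounded fourth moments, and
`∑_{i,j} P(|a_{i,j}| ≥ ε √N) → 0` for every `ε > 0`. -/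
structure MomentAssumption (P : Measure Ω) (A : (N : ℕ) → Ω → Matrix (Fin N) (Fin N) ℝ) :
    Prop where
  memLp : ∀ (N : ℕ) (i j : Fin N), MemLp (fun ω => A N ω i j) 4 P
  mean_zero : ∀ (N : ℕ) (i j : Fin N), ∫ ω, A N ω i j ∂P = 0
  second_moment : ∀ (N : ℕ) (i j : Fin N), ∫ ω, |A N ω i j| ^ 2 ∂P ≤ 1
  fourth_moment : ∃ K : ℝ, ∀ (N : ℕ) (i j : Fin N), ∫ ω, |A N ω i j| ^ 4 ∂P ≤ K
  tail : ∀ ε : ℝ, 0 < ε →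
    Tendsto (fun N : ℕ => ∑ i : Fin N, ∑ j : Fin N, P.real {ω | ε * √(N : ℝ) ≤ |A N ω i j|})
      atTop (𝓝 0)

/-- Condition `Σ(R)` on the tree sums. -/
def ConditionSigma (P : Measure Ω) (A : (N : ℕ) → Ω → Matrix (Fin N) (Fin N) ℝ) (R : ℝ) : Prop :=
  ∀ C₁ : ℝ, 0 < C₁ → ∃ C₂ : ℝ, 0 < C₂ ∧ ∃ N₀ : ℕ, 0 < N₀ ∧
    ∀ N k : ℕ, N₀ ≤ N → 1 ≤ k → (k : ℝ) ≤ C₁ * Real.log N →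
      treeSum (varProfile P (A N)) k ≤ C₂ * (N : ℝ) ^ (k + 1) * R ^ (2 * k)

end RandomMatrices

/-! The matrix is truncated at level $b=N^{7/16}$ and split into the centred truncation $X$, the
matrix of truncated means, and the cut-off part. The fourth moments make the means $O(b^{-3})$, so
their matrix has norm $O(N\,b^{-3})=o(\sqrt N)$. Two entries larger than $b$ share a row with
probability at most $N^3(K/b^4)^2\to0$ (`measure_two_large_entries_le`). Otherwise the cut-off part
has at most one nonzero entry per row and column, so its norm is at most its largest entry, which
the tail hypothesis makes at most $\delta\sqrt N$ with high probability.

For $X$, whose entries are at most $2b$, the moment method is run with $L=2k$ and $k$ of order $\log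
N$. In $\mathbf E\operatorname{tr}X^{L}$ only walks survive that use each pair of points at least
twice. Such a walk is an injectively labelled plane tree, formed by its first visits, together with
an exploration of this tree (`exists_labelled_exploration`). If the tree has $n$ edges, the
expectation is at most $(2b)^{L-2n}\prod s$, with the product over the tree edges
(`abs_integral_prod_le`).

The main point is to count the explorations of a given tree. When $L=2n$ there is only one. In
general, call a step neutral if it is neither the first nor the second use of a tree edge; there are
$L-2n$ of these. A default rule predicts all other steps, with at most one wrong prediction per
neutral step (`card_surprises_le`). Recording the at most $2(L-2n)$ failures of the rule recovers
the walk, so there are at most $(L(n+1)+1)^{2(L-2n)}$ explorations (`card_explorations_le`).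

Replacing $n$ by $n-1$ thus costs a factor polylogarithmic in $N$ times $b^2$, which is $o(N)$,
while $\Sigma(R)$ bounds the tree sums with a factor $NR^2$ per edge. The sum over $n$ is dominated
by a geometric series ending at $n=k$, and Markov's inequality concludes. -/

section Explorations

/-! ### Explorations of a plane tree and their default continuation. -/

/-- The step number `i` of the walk `a` runs along the edge between `c` and its parent. -/
def UsesEdge (a : ℕ → List ℕ) (c : List ℕ) (i : ℕ) : Prop :=
  (a i = c.tail ∧ a (i + 1) = c) ∨ (a i = c ∧ a (i + 1) = c.tail)

/-- The first `L` steps of `a` visit all vertices of `T`, starting at the root, such that a new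
vertex is always entered from its parent and after its elder siblings, and such that every edge
of `T` is used at least twice. -/
structure IsExploration (T : PlaneTree) (L : ℕ) (a : ℕ → List ℕ) : Prop where
  zero : a 0 = []
  mem : ∀ i ≤ L, a i ∈ T.verts
  visits : ∀ u ∈ T.verts, ∃ i ≤ L, a i = u
  enters : ∀ i < L, (∀ j ≤ i, a j ≠ a (i + 1)) →
    ∃ m, a (i + 1) = m :: a i ∧ ∀ m' < m, ∃ j ≤ i, a j = m' :: a i
  twice : ∀ c ∈ T.verts, c ≠ [] → ∃ i j, i < j ∧ j < L ∧ UsesEdge a c i ∧ UsesEdge a c j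

/-- If two edges were used by the same step in opposite directions, each lower end would be the tail
of the other, which the word lengths forbid. -/
theorem UsesEdge.unique {a : ℕ → List ℕ} {c d : List ℕ} {i : ℕ} (hc : c ≠ []) (hd : d ≠ [])
    (h : UsesEdge a c i) (h' : UsesEdge a d i) : c = d := by
  obtain ⟨m, u, rfl⟩ := List.exists_cons_of_ne_nil hc
  obtain ⟨n, v, rfl⟩ := List.exists_cons_of_ne_nil hd
  simp only [UsesEdge, List.tail_cons] at h h'
  rcases h with ⟨h1, h2⟩ | ⟨h1, h2⟩ <;> rcases h' with ⟨h3, h4⟩ | ⟨h3, h4⟩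
  · rw [← h2, h4]
  · have e1 : u = n :: v := h1.symm.trans h3
    have e2 : m :: u = v := h2.symm.trans h4
    have := congrArg List.length e1
    have := congrArg List.length e2
    simp at *
    omega
  · have e1 : m :: u = v := h1.symm.trans h3
    have e2 : u = n :: v := h2.symm.trans h4
    have := congrArg List.length e1
    have := congrArg List.length e2
    simp at *
    omega
  · rw [← h1, h3]

/-- Some element satisfying `p`, or `d` if there is none. -/
noncomputable def pickOr {β : Type*} (p : β → Prop) (d : β) : β :=
  open Classical in if h : ∃ c, p c then h.choose else d

theorem pickOr_of_unique {β : Type*} {p : β → Prop} {d x : β} (hx : p x) (h : ∀ y, p y → y = x) :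
    pickOr p d = x := by
  have h' : ∃ c, p c := ⟨x, hx⟩
  rw [pickOr, dif_pos h']
  exact h _ h'.choose_spec

theorem pickOr_of_not_exists {β : Type*} {p : β → Prop} {d : β} (h : ∀ y, ¬ p y) :
    pickOr p d = d := by
  rw [pickOr, dif_neg (by simpa using h)]

/-- `y` is the first child of `a t` that is not among `a 0, …, a t`. -/
def IsNextChild (T : PlaneTree) (a : ℕ → List ℕ) (t : ℕ) (y : List ℕ) : Prop :=
  ∃ m, y = m :: a t ∧ y ∈ T.verts ∧ (∀ j ≤ t, a j ≠ y) ∧ ∀ m' < m, ∃ j ≤ t, a j = m' :: a t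

/-- `y` is a child of `a t`, and the edge to it has been used exactly once before time `t`. -/
def IsOpenChild (a : ℕ → List ℕ) (t : ℕ) (y : List ℕ) : Prop :=
  ∃ m, y = m :: a t ∧ ∃ i < t, UsesEdge a y i ∧ ∀ j < t, UsesEdge a y j → j = i

/-- The default continuation of the walk `a 0, …, a t` in `T`. -/
noncomputable def defaultStep (T : PlaneTree) (a : ℕ → List ℕ) (t : ℕ) : List ℕ :=
  pickOr (IsNextChild T a t) (pickOr (IsOpenChild a t) (a t).tail)

theorem usesEdge_congr {a b : ℕ → List ℕ} {t : ℕ} (h : ∀ i ≤ t, a i = b i) (c : List ℕ) {i : ℕ}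
    (hi : i < t) : UsesEdge a c i ↔ UsesEdge b c i := by
  rw [UsesEdge, UsesEdge, h i hi.le, h (i + 1) hi]

/-- The rule looks only at the past of the walk. This is what allows a walk to be decoded step by
step from its surprises. -/
theorem defaultStep_congr (T : PlaneTree) {a b : ℕ → List ℕ} {t : ℕ} (h : ∀ i ≤ t, a i = b i) :
    defaultStep T a t = defaultStep T b t := by
  have h1 : IsNextChild T a t = IsNextChild T b t := by
    funext y
    rw [IsNextChild, IsNextChild, h t le_rfl]
    refine propext (exists_congr fun m => and_congr_right fun _ => and_congr_right fun _ => ?_)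
    refine and_congr ?_ ?_
    · exact forall₂_congr fun j hj => by rw [h j hj]
    · exact forall₂_congr fun m' _ => exists_congr fun j => and_congr_right fun hj => by rw [h j hj]
  have h2 : IsOpenChild a t = IsOpenChild b t := by
    funext y
    rw [IsOpenChild, IsOpenChild, h t le_rfl]
    refine propext (exists_congr fun m => and_congr_right fun _ => ?_)
    refine exists_congr fun i => and_congr_right fun hi => and_congr (usesEdge_congr h y hi) ?_
    exact forall₂_congr fun j hj => by rw [usesEdge_congr h y hj]
  rw [defaultStep, defaultStep, h1, h2, h t le_rfl]

namespace IsExploration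

variable {T : PlaneTree} {L : ℕ} {a : ℕ → List ℕ}

/-- Each edge has a step entering its lower end for the first time, and a second step using it. -/
theorem exists_first_second (h : IsExploration T L a) (c : List ℕ) (hc : c ∈ T.verts)
    (hc' : c ≠ []) : ∃ i j, i < j ∧ j < L ∧ a i = c.tail ∧ a (i + 1) = c ∧ (∀ l ≤ i, a l ≠ c) ∧
      UsesEdge a c j ∧ ∀ l < j, UsesEdge a c l → l = i := by
  classical
  have hv : ∃ i, a i = c := (h.visits c hc).imp fun i hi => hi.2
  obtain ⟨n, hn, hnc⟩ := h.visits c hc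
  have hfL : Nat.find hv ≤ L := (Nat.find_min' hv hnc).trans hn
  have hf0 : Nat.find hv ≠ 0 := by
    intro h0
    have := Nat.find_spec hv
    rw [h0, h.zero] at this
    exact hc' this.symm
  obtain ⟨i, hi⟩ := Nat.exists_eq_succ_of_ne_zero hf0
  have hic : a (i + 1) = c := by
    have := Nat.find_spec hv
    rwa [hi] at this
  have hmin : ∀ l ≤ i, a l ≠ c := fun l hl => Nat.find_min hv (by omega)
  have hit : a i = c.tail := by
    obtain ⟨m, hm, -⟩ := h.enters i (by omega) (by rw [hic]; exact hmin)
    rw [← hic, hm, List.tail_cons]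
  have hle : ∀ l, UsesEdge a c l → i ≤ l := by
    intro l hl
    by_contra hlt
    rcases hl with ⟨-, h2⟩ | ⟨h1, -⟩
    · exact hmin (l + 1) (by omega) h2
    · exact hmin l (by omega) h1
  have hsec : ∃ j, i < j ∧ UsesEdge a c j := by
    obtain ⟨p, q, hpq, -, hp, hq⟩ := h.twice c hc hc'
    exact ⟨q, (hle p hp).trans_lt hpq, hq⟩
  refine ⟨i, Nat.find hsec, (Nat.find_spec hsec).1, ?_, hit, hic, hmin, (Nat.find_spec hsec).2, ?_⟩
  · obtain ⟨p, q, hpq, hqL, hp, hq⟩ := h.twice c hc hc'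
    exact (Nat.find_min' hsec ⟨(hle p hp).trans_lt hpq, hq⟩).trans_lt hqL
  · intro l hl hul
    by_contra hne
    exact Nat.find_min hsec hl ⟨lt_of_le_of_ne (hle l hul) (Ne.symm hne), hul⟩

end IsExploration

/-! ### First uses, second uses and neutral steps. -/

/-- The times `f c < g c` of the first two uses of the edges of an exploration. -/
structure EdgeTimes (T : PlaneTree) (L : ℕ) (a : ℕ → List ℕ) (f g : List ℕ → ℕ) : Prop where
  lt : ∀ c ∈ T.verts.erase [], f c < g c
  g_lt : ∀ c ∈ T.verts.erase [], g c < L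
  at_f : ∀ c ∈ T.verts.erase [], a (f c) = c.tail
  at_f_succ : ∀ c ∈ T.verts.erase [], a (f c + 1) = c
  fresh : ∀ c ∈ T.verts.erase [], ∀ l ≤ f c, a l ≠ c
  uses_g : ∀ c ∈ T.verts.erase [], UsesEdge a c (g c)
  only : ∀ c ∈ T.verts.erase [], ∀ l < g c, UsesEdge a c l → l = f c

theorem IsExploration.exists_edgeTimes {T : PlaneTree} {L : ℕ} {a : ℕ → List ℕ}
    (h : IsExploration T L a) : ∃ f g, EdgeTimes T L a f g := by
  have := fun c (hc : c ∈ T.verts.erase []) =>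
    h.exists_first_second c (Finset.mem_of_mem_erase hc) (Finset.ne_of_mem_erase hc)
  choose! f g h1 h2 h3 h4 h5 h6 h7 using this
  exact ⟨f, g, h1, h2, h3, h4, h5, h6, h7⟩

namespace EdgeTimes

variable {T : PlaneTree} {L : ℕ} {a : ℕ → List ℕ} {f g : List ℕ → ℕ}

theorem uses_f (H : EdgeTimes T L a f g) {c : List ℕ} (hc : c ∈ T.verts.erase []) :
    UsesEdge a c (f c) := Or.inl ⟨H.at_f c hc, H.at_f_succ c hc⟩

theorem f_inj (H : EdgeTimes T L a f g) {c d : List ℕ} (hc : c ∈ T.verts.erase [])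
    (hd : d ∈ T.verts.erase []) (h : f c = f d) : c = d := by
  rw [← H.at_f_succ c hc, ← H.at_f_succ d hd, h]

theorem g_inj (H : EdgeTimes T L a f g) {c d : List ℕ} (hc : c ∈ T.verts.erase [])
    (hd : d ∈ T.verts.erase []) (h : g c = g d) : c = d :=
  (H.uses_g c hc).unique (Finset.ne_of_mem_erase hc) (Finset.ne_of_mem_erase hd)
    (h ▸ H.uses_g d hd)

theorem f_ne_g (H : EdgeTimes T L a f g) {c d : List ℕ} (hc : c ∈ T.verts.erase [])
    (hd : d ∈ T.verts.erase []) : f c ≠ g d := by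
  intro h
  have h' := (H.uses_f hc).unique (Finset.ne_of_mem_erase hc) (Finset.ne_of_mem_erase hd)
    (h ▸ H.uses_g d hd)
  subst h'
  exact (H.lt c hc).ne h

/-- The steps that are neither the first nor the second use of an edge. -/
noncomputable def neutral (T : PlaneTree) (L : ℕ) (f g : List ℕ → ℕ) : Finset ℕ :=
  Finset.range L \ ((T.verts.erase []).image f ∪ (T.verts.erase []).image g)

theorem mem_neutral {i : ℕ} : i ∈ neutral T L f g ↔
    i < L ∧ ∀ c ∈ T.verts.erase [], f c ≠ i ∧ g c ≠ i := by
  simp only [neutral, Finset.mem_sdiff, Finset.mem_range, Finset.mem_union, Finset.mem_image,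
    not_or, not_exists, not_and]
  exact and_congr_right fun _ => ⟨fun h c hc => ⟨h.1 c hc, h.2 c hc⟩,
    fun h => ⟨fun c hc => (h c hc).1, fun c hc => (h c hc).2⟩⟩

/-- Each edge accounts for exactly two steps that are not neutral, and these steps are distinct for
distinct edges. -/
theorem card_neutral (H : EdgeTimes T L a f g) :
    (neutral T L f g).card + 2 * (T.verts.card - 1) = L := by
  have hdisj : Disjoint ((T.verts.erase []).image f) ((T.verts.erase []).image g) := by
    rw [Finset.disjoint_left]
    intro i hi hi'
    obtain ⟨c, hc, rfl⟩ := Finset.mem_image.1 hi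
    obtain ⟨d, hd, hd'⟩ := Finset.mem_image.1 hi'
    exact H.f_ne_g hc hd hd'.symm
  have hsub : (T.verts.erase []).image f ∪ (T.verts.erase []).image g ⊆ Finset.range L := by
    intro i hi
    rcases Finset.mem_union.1 hi with hi | hi
    · obtain ⟨c, hc, rfl⟩ := Finset.mem_image.1 hi
      exact Finset.mem_range.2 ((H.lt c hc).trans (H.g_lt c hc))
    · obtain ⟨c, hc, rfl⟩ := Finset.mem_image.1 hi
      exact Finset.mem_range.2 (H.g_lt c hc)
  have h1 := Finset.card_sdiff_add_card_eq_card hsub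
  rw [Finset.card_union_of_disjoint hdisj, Finset.card_image_of_injOn fun c hc d hd => H.f_inj hc hd,
    Finset.card_image_of_injOn fun c hc d hd => H.g_inj hc hd, Finset.card_range,
    Finset.card_erase_of_mem T.root_mem] at h1
  rw [neutral]
  omega

/-- The balance of arrivals and departures at `u` before a visit to `u` at time `t`: there are
at most as many second uses of edges starting at `u` as neutral arrivals at `u`. -/
theorem card_second_le (h : IsExploration T L a) (H : EdgeTimes T L a f g) {u : List ℕ} {t : ℕ}
    (ht : t ≤ L) (hu : a t = u) (B : Finset ℕ)
    (hB : ∀ i ∈ B, i < t ∧ a i = u ∧ ∃ c ∈ T.verts.erase [], g c = i) (hB' : B.Nonempty) :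
    B.card ≤ ((neutral T L f g).filter fun i => a (i + 1) = u).card := by
  classical
  set V := T.verts.erase [] with hV
  set Dep := (Finset.range t).filter fun i => a i = u with hDep
  set Arr := (Finset.range t).filter fun i => a (i + 1) = u with hArr
  set Ch := V.filter fun c => c.tail = u with hCh
  set ChP := Ch.filter fun c => f c < t with hChP
  set ChD := Ch.filter fun c => g c < t ∧ a (g c) = u with hChD
  set ChU := Ch.filter fun c => g c < t ∧ a (g c + 1) = u with hChU
  set Up := V.filter fun c => c = u ∧ g c < t ∧ a (g c) = u with hUp
  set Sp := V.filter fun c => c = u ∧ g c < t ∧ a (g c + 1) = u with hSp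
  set PA := V.filter fun c => c = u with hPA
  set Sn := (neutral T L f g).filter fun i => a (i + 1) = u with hSn
  have hne : ∀ c ∈ V, c.tail ≠ c := by
    intro c hc e
    obtain ⟨m, v, rfl⟩ := List.exists_cons_of_ne_nil (Finset.ne_of_mem_erase hc)
    have := congrArg List.length e
    simp at this
  have hends : ∀ c ∈ V, a (g c) ≠ a (g c + 1) := by
    intro c hc e
    rcases H.uses_g c hc with ⟨h1, h2⟩ | ⟨h1, h2⟩
    · exact hne c hc (by rw [← h1, e, h2])
    · exact hne c hc (by rw [← h2, ← e, h1])
  -- Both sides count the visits to `u` at times `0, …, t`: the left one splits off time `t`, the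
  -- right one time `0`.
  have hbal : Dep.card + 1 = Arr.card + if a 0 = u then 1 else 0 := by
    have h1 : ((Finset.range (t + 1)).filter fun i => a i = u).card = Dep.card + 1 := by
      rw [Finset.range_add_one, Finset.filter_insert, if_pos hu, Finset.card_insert_of_notMem]
      simp
    rw [← h1, Finset.card_filter, Finset.sum_range_succ', hArr, Finset.card_filter]
  -- The root has no parent edge, and any other vertex is not the starting point.
  have hroot : PA.card + (if a 0 = u then 1 else 0) ≤ 1 := by
    have h1 : PA.card ≤ 1 := Finset.card_le_one.2 fun c hc d hd => by
      rw [(Finset.mem_filter.1 hc).2, (Finset.mem_filter.1 hd).2]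
    split_ifs with h0
    · have : PA = ∅ := by
        refine Finset.filter_eq_empty_iff.2 fun c hc e => Finset.ne_of_mem_erase hc ?_
        rw [e, ← h0, h.zero]
      simp [this]
    · simpa using h1
  have hUS : Up.card + Sp.card ≤ 1 := by
    have hd : Disjoint Up Sp := by
      rw [Finset.disjoint_left]
      intro c hc hc'
      have h1 := Finset.mem_filter.1 hc
      exact hends c h1.1 (h1.2.2.2.trans (Finset.mem_filter.1 hc').2.2.2.symm)
    rw [← Finset.card_union_of_disjoint hd]
    refine Finset.card_le_one.2 fun c hc d hd => ?_
    have : ∀ e ∈ Up ∪ Sp, e = u := by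
      intro e he
      rcases Finset.mem_union.1 he with he | he
      · exact (Finset.mem_filter.1 he).2.1
      · exact (Finset.mem_filter.1 he).2.1
    rw [this c hc, this d hd]
  -- A second use of a child edge, in either direction, is preceded by its first use, which departs
  -- from `u`.
  have hDU : ChD.card + ChU.card ≤ ChP.card := by
    have hd : Disjoint ChD ChU := by
      rw [Finset.disjoint_left]
      intro c hc hc'
      have h1 := Finset.mem_filter.1 hc
      exact hends c (Finset.mem_filter.1 h1.1).1 (h1.2.2.trans (Finset.mem_filter.1 hc').2.2.symm)
    rw [← Finset.card_union_of_disjoint hd]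
    refine Finset.card_le_card fun c hc => ?_
    have hc2 : c ∈ Ch ∧ g c < t := by
      rcases Finset.mem_union.1 hc with he | he
      · exact ⟨(Finset.mem_filter.1 he).1, (Finset.mem_filter.1 he).2.1⟩
      · exact ⟨(Finset.mem_filter.1 he).1, (Finset.mem_filter.1 he).2.1⟩
    exact Finset.mem_filter.2 ⟨hc2.1, (H.lt c (Finset.mem_filter.1 hc2.1).1).trans hc2.2⟩
  have hsub1 : Arr ⊆ PA.image f ∪ ChU.image g ∪ Sp.image g ∪ Sn := by
    intro i hi
    obtain ⟨hit, hiu⟩ := Finset.mem_filter.1 hi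
    rw [Finset.mem_range] at hit
    by_cases hn : i ∈ neutral T L f g
    · exact Finset.mem_union_right _ (Finset.mem_filter.2 ⟨hn, hiu⟩)
    refine Finset.mem_union_left _ ?_
    rw [mem_neutral] at hn
    push Not at hn
    obtain ⟨c, hc, hfg⟩ := hn (by omega)
    by_cases hfi : f c = i
    · refine Finset.mem_union_left _ (Finset.mem_union_left _ (Finset.mem_image.2 ⟨c, ?_, hfi⟩))
      refine Finset.mem_filter.2 ⟨hc, ?_⟩
      rw [← H.at_f_succ c hc, hfi, hiu]
    · have hgi := hfg hfi
      subst hgi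
      rcases H.uses_g c hc with ⟨h1, h2⟩ | ⟨h1, h2⟩
      · exact Finset.mem_union_right _ (Finset.mem_image.2
          ⟨c, Finset.mem_filter.2 ⟨hc, h2.symm.trans hiu, hit, hiu⟩, rfl⟩)
      · exact Finset.mem_union_left _ (Finset.mem_union_right _ (Finset.mem_image.2
          ⟨c, Finset.mem_filter.2 ⟨Finset.mem_filter.2 ⟨hc, h2.symm.trans hiu⟩, hit, hiu⟩, rfl⟩))
  have hArrle : Arr.card ≤ PA.card + ChU.card + Sp.card + Sn.card := by
    refine (Finset.card_le_card hsub1).trans ((Finset.card_union_le _ _).trans ?_)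
    refine add_le_add ((Finset.card_union_le _ _).trans (add_le_add
      ((Finset.card_union_le _ _).trans (add_le_add ?_ ?_)) ?_)) le_rfl <;>
    exact Finset.card_image_le
  have hCV : ∀ c ∈ Ch, c ∈ V := fun c hc => (Finset.mem_filter.1 hc).1
  have hgim : (ChD ∪ Up).card = ChD.card + Up.card := by
    refine Finset.card_union_of_disjoint (Finset.disjoint_left.2 fun c hc hc' => ?_)
    have h1 := (Finset.mem_filter.1 (Finset.mem_filter.1 hc).1)
    exact hne c h1.1 (h1.2.trans (Finset.mem_filter.1 hc').2.1.symm)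
  have hDUV : ∀ c ∈ ChD ∪ Up, c ∈ V ∧ g c < t ∧ a (g c) = u := by
    intro c hc
    rcases Finset.mem_union.1 hc with he | he
    · exact ⟨hCV c (Finset.mem_filter.1 he).1, (Finset.mem_filter.1 he).2⟩
    · exact ⟨(Finset.mem_filter.1 he).1, (Finset.mem_filter.1 he).2.2⟩
  have hgcard : ((ChD ∪ Up).image g).card = ChD.card + Up.card := by
    rw [Finset.card_image_of_injOn, hgim]
    exact fun c hc d hd => H.g_inj (hDUV c hc).1 (hDUV d hd).1
  have hfcard : (ChP.image f).card = ChP.card := by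
    rw [Finset.card_image_of_injOn]
    exact fun c hc d hd => H.f_inj (hCV c (Finset.mem_filter.1 hc).1)
      (hCV d (Finset.mem_filter.1 hd).1)
  have hDeple : ChP.card + (ChD.card + Up.card) ≤ Dep.card := by
    rw [← hfcard, ← hgcard, ← Finset.card_union_of_disjoint]
    · refine Finset.card_le_card fun i hi => ?_
      rcases Finset.mem_union.1 hi with hi | hi
      · obtain ⟨c, hc, rfl⟩ := Finset.mem_image.1 hi
        obtain ⟨hc1, hc2⟩ := Finset.mem_filter.1 hc
        refine Finset.mem_filter.2 ⟨Finset.mem_range.2 hc2, ?_⟩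
        rw [H.at_f c (hCV c hc1), (Finset.mem_filter.1 hc1).2]
      · obtain ⟨c, hc, rfl⟩ := Finset.mem_image.1 hi
        exact Finset.mem_filter.2 ⟨Finset.mem_range.2 (hDUV c hc).2.1, (hDUV c hc).2.2⟩
    · refine Finset.disjoint_left.2 fun i hi hi' => ?_
      obtain ⟨c, hc, rfl⟩ := Finset.mem_image.1 hi
      obtain ⟨d, hd, hd'⟩ := Finset.mem_image.1 hi'
      exact H.f_ne_g (hCV c (Finset.mem_filter.1 hc).1) (hDUV d hd).1 hd'.symm
  have hBle : B.card ≤ ChD.card + Up.card := by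
    rw [← hgcard]
    refine Finset.card_le_card fun i hi => ?_
    obtain ⟨hit, hiu, c, hc, rfl⟩ := hB i hi
    refine Finset.mem_image_of_mem g ?_
    rcases H.uses_g c hc with ⟨h1, h2⟩ | ⟨h1, h2⟩
    · exact Finset.mem_union_left _ (Finset.mem_filter.2
        ⟨Finset.mem_filter.2 ⟨hc, h1.symm.trans hiu⟩, hit, hiu⟩)
    · exact Finset.mem_union_right _ (Finset.mem_filter.2 ⟨hc, h1.symm.trans hiu, hit, hiu⟩)
  -- Combined, the counts give `2 * ChD.card + Up.card ≤ Sp.card + Sn.card`. If the second use of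
  -- the parent edge arrives at `u`, so that `Sp.card = 1` and `Up.card = 0`, the extra unit is
  -- absorbed by `1 ≤ ChD.card`, which holds because `B` is nonempty.
  have hBpos := hB'.card_pos
  omega

/-- A second use of an edge that is not the default step is followed by another visit to its
starting point. -/
theorem exists_revisit (h : IsExploration T L a) (H : EdgeTimes T L a f g) {c : List ℕ}
    (hc : c ∈ T.verts.erase []) (hdef : a (g c + 1) ≠ defaultStep T a (g c)) :
    ∃ t, g c < t ∧ t ≤ L ∧ a t = a (g c) := by
  by_contra hno
  push Not at hno
  have hgL := H.g_lt c hc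
  have hmemV : ∀ m, (m :: a (g c)) ∈ T.verts → (m :: a (g c)) ∈ T.verts.erase [] := fun m hm =>
    Finset.mem_erase.2 ⟨by simp, hm⟩
  -- An unvisited child has to be entered from `a (g c)` later, which would be a return.
  have hnext : ∀ y, ¬ IsNextChild T a (g c) y := by
    rintro y ⟨m, rfl, hy, hun, -⟩
    have hy' := hmemV m hy
    have hft : g c ≤ f (m :: a (g c)) := by
      by_contra hlt
      exact hun (f (m :: a (g c)) + 1) (by omega) (H.at_f_succ _ hy')
    have hne : g c ≠ f (m :: a (g c)) := (H.f_ne_g hy' hc).symm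
    refine hno (f (m :: a (g c))) (by omega) ((H.lt _ hy').trans (H.g_lt _ hy')).le ?_
    simpa using H.at_f _ hy'
  -- The second use of an open edge is still to come. Unless it is the present step, it touches the
  -- upper end `a (g c)` again.
  have hopen : ∀ y, IsOpenChild a (g c) y → y = c := by
    rintro y ⟨m, rfl, i, hi, hui, hu'⟩
    have hy : (m :: a (g c)) ∈ T.verts := by
      rcases hui with ⟨-, h2⟩ | ⟨h1, -⟩
      · exact h2 ▸ h.mem (i + 1) (by omega)
      · exact h1 ▸ h.mem i (by omega)
    have hy' := hmemV m hy
    have hle : g c ≤ g (m :: a (g c)) := by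
      by_contra hlt
      have hlt' := H.lt _ hy'
      have e1 := hu' _ (by omega) (H.uses_f hy')
      have e2 := hu' _ (by omega) (H.uses_g _ hy')
      omega
    by_contra hne
    have hgne : g c ≠ g (m :: a (g c)) := fun e => hne (H.g_inj hc hy' e).symm
    have hgL' := H.g_lt _ hy'
    rcases H.uses_g _ hy' with ⟨h1, -⟩ | ⟨-, h2⟩
    · exact hno _ (by omega) hgL'.le (by simpa using h1)
    · exact hno (g (m :: a (g c)) + 1) (by omega) hgL' (by simpa using h2)
  apply hdef
  rw [defaultStep, pickOr_of_not_exists hnext]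
  rcases H.uses_g c hc with ⟨h1, h2⟩ | ⟨h1, h2⟩
  · rw [h2]
    refine (pickOr_of_unique ?_ hopen).symm
    obtain ⟨m, v, rfl⟩ := List.exists_cons_of_ne_nil (Finset.ne_of_mem_erase hc)
    refine ⟨m, by rw [h1]; simp, f _, H.lt _ hc, H.uses_f hc, fun j hj => H.only _ hc j hj⟩
  · rw [pickOr_of_not_exists, h1, h2]
    intro y hy
    have hyc := hopen y hy
    obtain ⟨m, rfl, -⟩ := hy
    rw [h1] at hyc
    have := congrArg List.length hyc
    simp at this

end EdgeTimes

/-! ### Surprises, and the number of explorations. -/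

/-- The times of the steps that are not default steps. -/
noncomputable def surprises (T : PlaneTree) (L : ℕ) (a : ℕ → List ℕ) : Finset ℕ :=
  (Finset.range L).filter fun t => a (t + 1) ≠ defaultStep T a t

-- First uses are never surprises. Surprising second uses are charged, vertex by vertex, to neutral
-- arrivals at their starting point, and each neutral step may itself be a surprise. This gives at
-- most two surprises per neutral step.
open EdgeTimes in
theorem IsExploration.card_surprises_le {T : PlaneTree} {L : ℕ} {a : ℕ → List ℕ}
    (h : IsExploration T L a) :
    (surprises T L a).card + 4 * (T.verts.card - 1) ≤ 2 * L := by
  classical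
  obtain ⟨f, g, H⟩ := h.exists_edgeTimes
  have hcard := H.card_neutral
  set S := surprises T L a with hS
  set N := neutral T L f g with hN
  -- An exploration enters siblings in order, so the new vertex is the unique next child, and the
  -- rule tries next children before anything else.
  have hplus : ∀ c ∈ T.verts.erase [], f c ∉ S := by
    intro c hc hmem
    have hfL : f c < L := (H.lt c hc).trans (H.g_lt c hc)
    refine (Finset.mem_filter.1 hmem).2 ?_
    rw [defaultStep]
    obtain ⟨m, hm, hm'⟩ := h.enters (f c) hfL (by rw [H.at_f_succ c hc]; exact H.fresh c hc)
    have hx : IsNextChild T a (f c) (a (f c + 1)) :=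
      ⟨m, hm, h.mem _ hfL, by rw [H.at_f_succ c hc]; exact H.fresh c hc, hm'⟩
    refine (pickOr_of_unique hx ?_).symm
    rintro y ⟨n, rfl, -, hn, hn'⟩
    rw [hm]
    rcases lt_trichotomy n m with hlt | rfl | hlt
    · obtain ⟨j, hj, hj'⟩ := hm' n hlt
      exact absurd hj' (hn j hj)
    · rfl
    · obtain ⟨j, hj, hj'⟩ := hn' m hlt
      rw [← hm, H.at_f_succ c hc] at hj'
      exact absurd hj' (H.fresh c hc j hj)
  have hminus : ∀ i ∈ S \ N, ∃ c ∈ T.verts.erase [], g c = i := by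
    intro i hi
    obtain ⟨hi1, hi2⟩ := Finset.mem_sdiff.1 hi
    rw [hN, mem_neutral] at hi2
    push Not at hi2
    obtain ⟨c, hc, hc'⟩ := hi2 (Finset.mem_range.1 (Finset.mem_filter.1 hi1).1)
    exact ⟨c, hc, hc' fun e => hplus c hc (e ▸ hi1)⟩
  have hfib : (S \ N).card ≤ N.card := by
    have h1 : (↑(S \ N) : Set ℕ).MapsTo a T.verts := by
      intro i hi
      have := Finset.mem_range.1 (Finset.mem_filter.1 (Finset.mem_sdiff.1 hi).1).1
      exact h.mem i this.le
    have h2 : (N : Set ℕ).MapsTo (fun i => a (i + 1)) T.verts := by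
      intro i hi
      exact h.mem _ (mem_neutral.1 hi).1
    rw [Finset.card_eq_sum_card_fiberwise h1, Finset.card_eq_sum_card_fiberwise h2]
    refine Finset.sum_le_sum fun u _ => ?_
    rcases ((S \ N).filter fun i => a i = u).eq_empty_or_nonempty with he | hne
    · simp [he]
    -- The latest surprise at `u` is followed by a revisit; applying the balance at that revisit
    -- covers all of `B` at once.
    set B := (S \ N).filter fun i => a i = u with hB
    obtain ⟨hm1, hm2⟩ := Finset.mem_filter.1 (B.max'_mem hne)
    obtain ⟨c, hc, hgc⟩ := hminus _ hm1
    obtain ⟨t, ht, htL, hta⟩ := exists_revisit h H hc (by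
      rw [hgc]; exact (Finset.mem_filter.1 (Finset.mem_sdiff.1 hm1).1).2)
    refine card_second_le h H htL (hta.trans (by rw [hgc, hm2])) B (fun i hi => ?_) hne
    refine ⟨lt_of_le_of_lt (B.le_max' i hi) (hgc ▸ ht), (Finset.mem_filter.1 hi).2, ?_⟩
    exact hminus i (Finset.mem_filter.1 hi).1
  have hle : S.card ≤ (S \ N).card + N.card := Finset.card_le_card_sdiff_add_card
  omega

theorem IsExploration.two_mul_le {T : PlaneTree} {L : ℕ} {a : ℕ → List ℕ}
    (h : IsExploration T L a) : 2 * (T.verts.card - 1) ≤ L := by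
  obtain ⟨f, g, H⟩ := h.exists_edgeTimes
  have := H.card_neutral
  omega

/-- A finite walk, continued by staying at its last point. -/
def extendWalk {α : Type*} {L : ℕ} (w : Fin (L + 1) → α) (i : ℕ) : α :=
  w ⟨min i L, by omega⟩

theorem extendWalk_of_le {α : Type*} {L : ℕ} (w : Fin (L + 1) → α) {i : ℕ} (hi : i ≤ L) :
    extendWalk w i = w ⟨i, by omega⟩ := by
  simp [extendWalk, hi]

/-- A set with at most `m` elements is listed by a map from `Fin m`, padded with `none`. -/
theorem card_finset_le_pow (X : Type*) [Fintype X] [DecidableEq X] (m : ℕ) :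
    (Finset.univ.filter fun s : Finset X => s.card ≤ m).card ≤ (Fintype.card X + 1) ^ m := by
  have h : (Finset.univ.filter fun s : Finset X => s.card ≤ m) ⊆
      (Finset.univ : Finset (Fin m → Option X)).image
        fun F => Finset.univ.filter fun x => ∃ i, F i = some x := by
    intro s hs
    have hs' : s.card ≤ m := (Finset.mem_filter.1 hs).2
    refine Finset.mem_image.2 ⟨fun i => if h : i.1 < s.card then
      some (s.equivFin.symm ⟨i.1, h⟩).1 else none, Finset.mem_univ _, ?_⟩
    ext x
    simp only [Finset.mem_filter, Finset.mem_univ, true_and]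
    constructor
    · rintro ⟨i, hi⟩
      split_ifs at hi with hlt
      · rw [← Option.some.inj hi]
        exact (s.equivFin.symm ⟨i.1, hlt⟩).2
    · intro hx
      refine ⟨⟨(s.equivFin ⟨x, hx⟩).1, (s.equivFin ⟨x, hx⟩).2.trans_le hs'⟩, ?_⟩
      simp
  refine (Finset.card_le_card h).trans (Finset.card_image_le.trans ?_)
  simp

open Classical in
/-- The explorations of `T` of length `L`. -/
noncomputable def explorations (T : PlaneTree) (L : ℕ) : Finset (Fin (L + 1) → T.verts) :=
  Finset.univ.filter fun a => IsExploration T L fun i => (extendWalk a i).1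

/-- The surprises, recorded as pairs of a time and the vertex reached, determine the exploration: at
all other times it follows the default rule. -/
theorem card_explorations_le (T : PlaneTree) (L m : ℕ)
    (hm : 2 * L ≤ m + 4 * (T.verts.card - 1)) :
    (explorations T L).card ≤ (L * T.verts.card + 1) ^ m := by
  classical
  have hX : Fintype.card (Fin L × T.verts) = L * T.verts.card := by simp
  rw [← hX]
  refine le_trans ?_ (card_finset_le_pow (Fin L × T.verts) m)
  refine Finset.card_le_card_of_injOn
    (fun a => Finset.univ.filter fun p : Fin L × T.verts =>
      (extendWalk a (p.1 + 1)).1 ≠ defaultStep T (fun i => (extendWalk a i).1) p.1 ∧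
        p.2 = extendWalk a (p.1 + 1)) ?_ ?_
  · intro a ha
    have ha' := (Finset.mem_filter.1 ha).2
    have h1 := ha'.card_surprises_le
    refine Finset.mem_filter.2 ⟨Finset.mem_univ _, ?_⟩
    refine le_trans ?_ (show (surprises T L fun i => (extendWalk a i).1).card ≤ m by omega)
    refine Finset.card_le_card_of_injOn (fun p => p.1.1) ?_ ?_
    · intro p hp
      exact Finset.mem_filter.2 ⟨Finset.mem_range.2 p.1.2, (Finset.mem_filter.1 hp).2.1⟩
    · intro p hp q hq hpq
      have hpq' : p.1 = q.1 := Fin.ext hpq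
      refine Prod.ext hpq' ?_
      rw [(Finset.mem_filter.1 hp).2.2, (Finset.mem_filter.1 hq).2.2, hpq']
  · intro a ha b hb hab
    have key : ∀ i ≤ L, ∀ j ≤ i, extendWalk a j = extendWalk b j := by
      intro i
      induction i with
      | zero =>
        intro _ j hj
        obtain rfl : j = 0 := by omega
        exact Subtype.ext ((Finset.mem_filter.1 ha).2.zero.trans (Finset.mem_filter.1 hb).2.zero.symm)
      | succ i ih =>
        intro hi j hj
        have ih' := ih (by omega)
        rcases Nat.lt_or_ge i j with hlt | hge
        swap
        · exact ih' j hge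
        obtain rfl : j = i + 1 := by omega
        have hcongr : defaultStep T (fun i => (extendWalk a i).1) i =
            defaultStep T (fun i => (extendWalk b i).1) i :=
          defaultStep_congr T fun j hj => by rw [ih' j hj]
        have hiff := fun x => Finset.ext_iff.1 hab (⟨i, by omega⟩, x)
        simp only [Finset.mem_filter, Finset.mem_univ, true_and] at hiff
        by_cases hda : (extendWalk a (i + 1)).1 = defaultStep T (fun i => (extendWalk a i).1) i
        · by_cases hdb : (extendWalk b (i + 1)).1 = defaultStep T (fun i => (extendWalk b i).1) i
          · exact Subtype.ext (by rw [hda, hdb, hcongr])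
          · exact (((hiff _).2 ⟨hdb, rfl⟩).2).symm
        · exact ((hiff _).1 ⟨hda, rfl⟩).2
    funext i
    have := key L le_rfl i.1 (by omega)
    rwa [extendWalk_of_le a (by omega), extendWalk_of_le b (by omega)] at this

end Explorations

/-! ### From a doubled walk to a labelled exploration. -/

section Addresses

variable {α : Type*}

/-- The walk `w` visits a new point by its step number `i`. -/
def IsNewStep (w : ℕ → α) (i : ℕ) : Prop := ∀ j ≤ i, w j ≠ w (i + 1)

open Classical in
/-- The number of steps before time `i` that lead from `w i` to a new point. -/
noncomputable def newCount (w : ℕ → α) (i : ℕ) : ℕ :=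
  Nat.count (fun j => IsNewStep w j ∧ w j = w i) i

/-- The time of the first visit of `w` to `w i`. -/
noncomputable def firstVisit (w : ℕ → α) (i : ℕ) : ℕ := sInf {j | w j = w i}

theorem firstVisit_spec (w : ℕ → α) (i : ℕ) : w (firstVisit w i) = w i :=
  Nat.sInf_mem (s := {j | w j = w i}) ⟨i, rfl⟩

theorem firstVisit_le {w : ℕ → α} {i j : ℕ} (h : w j = w i) : firstVisit w i ≤ j :=
  Nat.sInf_le (s := {j | w j = w i}) h

/-- The address of `w i` in the tree of first visits of the walk `w`. -/
noncomputable def address (w : ℕ → α) : ℕ → List ℕ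
  | 0 => []
  | i + 1 =>
    if firstVisit w (i + 1) < i + 1 then address w (firstVisit w (i + 1))
    else newCount w i :: address w i

theorem address_zero (w : ℕ → α) : address w 0 = [] := by
  rw [address]

theorem address_succ_of_new {w : ℕ → α} {i : ℕ} (h : IsNewStep w i) :
    address w (i + 1) = newCount w i :: address w i := by
  rw [address, if_neg]
  exact fun hlt => h _ (Nat.lt_succ_iff.1 hlt) (firstVisit_spec w (i + 1))

/-- Every time has the same address as the first visit of the same point. -/
theorem exists_first_visit (w : ℕ → α) (i : ℕ) : ∃ j ≤ i, w j = w i ∧ address w j = address w i ∧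
    (∀ l < j, w l ≠ w i) ∧ (j = 0 ∨ ∃ j', j = j' + 1 ∧ IsNewStep w j') := by
  have hle : firstVisit w i ≤ i := firstVisit_le rfl
  have hmin : ∀ l < firstVisit w i, w l ≠ w i := fun l hl h => (firstVisit_le h).not_gt hl
  refine ⟨firstVisit w i, hle, firstVisit_spec w i, ?_, hmin, ?_⟩
  · rcases hle.eq_or_lt with he | hlt
    · rw [he]
    obtain ⟨k, rfl⟩ : ∃ k, i = k + 1 := ⟨i - 1, by omega⟩
    conv_rhs => rw [address, if_pos hlt]
  · rcases Nat.eq_zero_or_pos (firstVisit w i) with h0 | hpos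
    · exact Or.inl h0
    obtain ⟨j', hj'⟩ : ∃ j', firstVisit w i = j' + 1 := ⟨firstVisit w i - 1, by omega⟩
    refine Or.inr ⟨j', hj', fun l hl => ?_⟩
    rw [← hj', firstVisit_spec w i]
    exact hmin l (by omega)

theorem address_eq_of_eq {w : ℕ → α} {i j : ℕ} (h : w i = w j) : address w i = address w j := by
  obtain ⟨i', -, hi1, hi2, hi3, -⟩ := exists_first_visit w i
  obtain ⟨j', -, hj1, hj2, hj3, -⟩ := exists_first_visit w j
  have : i' = j' := by
    rcases lt_trichotomy i' j' with hlt | he | hlt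
    · exact absurd (hi1.trans h) (hj3 _ hlt)
    · exact he
    · exact absurd (hj1.trans h.symm) (hi3 _ hlt)
  rw [← hi2, ← hj2, this]

theorem newCount_lt {w : ℕ → α} {i j : ℕ} (hij : i < j) (hi : IsNewStep w i) (h : w i = w j) :
    newCount w i < newCount w j := by
  classical
  rw [newCount, newCount, h]
  exact Nat.count_strict_mono ⟨hi, h⟩ hij

/-- The witness is the new step from `w i` with index `m`, counted from zero. This yields
consecutive numbering of children and entry after elder siblings. -/
theorem exists_newCount_eq {w : ℕ → α} {i m : ℕ} (hm : m < newCount w i) :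
    ∃ j < i, IsNewStep w j ∧ w j = w i ∧ newCount w j = m := by
  classical
  set p : ℕ → Prop := fun j => IsNewStep w j ∧ w j = w i with hp
  have hlt : Nat.nth p m < i := Nat.nth_lt_of_lt_count hm
  have hcard : ∀ hf : (Set.ofPred p).Finite, m < hf.toFinset.card := by
    intro hf
    refine hm.trans_le ?_
    rw [newCount, Nat.count_eq_card_filter_range]
    refine Finset.card_le_card fun j hj => ?_
    rw [Set.Finite.mem_toFinset]
    exact (Finset.mem_filter.1 hj).2
  obtain ⟨h1, h2⟩ := Nat.nth_mem m hcard
  refine ⟨Nat.nth p m, hlt, h1, h2, ?_⟩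
  rw [newCount, h2]
  exact Nat.count_nth hcard

/-- Compare first visits. Equal tails give the same predecessor by induction, and equal heads then
give the same step, since successive new steps from one point receive increasing numbers. -/
theorem eq_of_address_eq (w : ℕ → α) : ∀ n, ∀ i ≤ n, ∀ j ≤ n, address w i = address w j →
    w i = w j := by
  intro n
  induction n with
  | zero =>
    intro i hi j hj _
    rw [Nat.le_zero.1 hi, Nat.le_zero.1 hj]
  | succ n ih =>
    intro i hi j hj h
    obtain ⟨i', hi', hi1, hi2, -, hi3⟩ := exists_first_visit w i
    obtain ⟨j', hj', hj1, hj2, -, hj3⟩ := exists_first_visit w j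
    rw [← hi1, ← hj1]
    rw [← hi2, ← hj2] at h
    rcases hi3 with rfl | ⟨i, rfl, hin⟩ <;> rcases hj3 with rfl | ⟨j, rfl, hjn⟩
    · rfl
    · rw [address_zero, address_succ_of_new hjn] at h
      simp at h
    · rw [address_zero, address_succ_of_new hin] at h
      simp at h
    · rw [address_succ_of_new hin, address_succ_of_new hjn, List.cons.injEq] at h
      have hij := ih i (by omega) j (by omega) h.2
      rcases lt_trichotomy i j with hlt | rfl | hlt
      · exact absurd h.1 (newCount_lt hlt hin hij).ne
      · rfl
      · exact absurd h.1.symm (newCount_lt hlt hjn hij.symm).ne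

/-- The tree of first visits of the first `L` steps of a walk. -/
noncomputable def visitTree (w : ℕ → α) (L : ℕ) : PlaneTree where
  verts := (Finset.range (L + 1)).image (address w)
  root_mem := Finset.mem_image.2 ⟨0, by simp, address_zero w⟩
  tail_mem := by
    intro j u h
    obtain ⟨i, hi, hiu⟩ := Finset.mem_image.1 h
    rw [Finset.mem_range] at hi
    obtain ⟨i', hi', -, hi2, -, rfl | ⟨i, rfl, hin⟩⟩ := exists_first_visit w i
    · rw [← hi2, address_zero] at hiu
      simp at hiu
    · rw [← hi2, address_succ_of_new hin, List.cons.injEq] at hiu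
      exact Finset.mem_image.2 ⟨i, Finset.mem_range.2 (by omega), hiu.2⟩
  pred_mem := by
    intro j u h
    obtain ⟨i, hi, hiu⟩ := Finset.mem_image.1 h
    rw [Finset.mem_range] at hi
    obtain ⟨i', hi', -, hi2, -, rfl | ⟨i, rfl, hin⟩⟩ := exists_first_visit w i
    · rw [← hi2, address_zero] at hiu
      simp at hiu
    · rw [← hi2, address_succ_of_new hin, List.cons.injEq] at hiu
      obtain ⟨l, hl, hl1, hl2, hl3⟩ := exists_newCount_eq (w := w) (i := i) (m := j) (by omega)
      refine Finset.mem_image.2 ⟨l + 1, Finset.mem_range.2 (by omega), ?_⟩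
      rw [address_succ_of_new hl1, hl3, address_eq_of_eq hl2, hiu.2]

/-- Each of the first `L` steps of `w` runs along the same pair of points as another one. -/
def IsDoubled (w : ℕ → α) (L : ℕ) : Prop :=
  ∀ i < L, ∃ j < L, j ≠ i ∧
    ((w j = w i ∧ w (j + 1) = w (i + 1)) ∨ (w j = w (i + 1) ∧ w (j + 1) = w i))

/-- A vertex other than the root is first entered by a new step along its parent edge. The partner
of this step in the doubled walk is another use of the same edge, because equal points have equal
addresses. -/
theorem isExploration_address {w : ℕ → α} {L : ℕ} (hw : IsDoubled w L) :
    IsExploration (visitTree w L) L (address w) where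
  zero := address_zero w
  mem i hi := Finset.mem_image.2 ⟨i, Finset.mem_range.2 (by omega), rfl⟩
  visits u hu := by
    obtain ⟨i, hi, hiu⟩ := Finset.mem_image.1 hu
    exact ⟨i, Nat.lt_succ_iff.1 (Finset.mem_range.1 hi), hiu⟩
  enters i _ hi := by
    have hin : IsNewStep w i := fun j hj h => hi j hj (address_eq_of_eq h)
    refine ⟨newCount w i, address_succ_of_new hin, fun m hm => ?_⟩
    obtain ⟨l, hl, hl1, hl2, hl3⟩ := exists_newCount_eq hm
    exact ⟨l + 1, hl, by rw [address_succ_of_new hl1, hl3, address_eq_of_eq hl2]⟩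
  twice c hc hc' := by
    obtain ⟨i, hi, hic⟩ := Finset.mem_image.1 hc
    rw [Finset.mem_range] at hi
    obtain ⟨i', hi', -, hi2, -, rfl | ⟨i, rfl, hin⟩⟩ := exists_first_visit w i
    · rw [← hi2, address_zero] at hic
      exact absurd hic.symm hc'
    have hci : address w (i + 1) = c := hi2.trans hic
    have hti : address w i = c.tail := by rw [← hci, address_succ_of_new hin, List.tail_cons]
    have hui : UsesEdge (address w) c i := Or.inl ⟨hti, hci⟩
    obtain ⟨j, hj, hne, hj'⟩ := hw i (by omega)
    have huj : UsesEdge (address w) c j := by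
      rcases hj' with ⟨h1, h2⟩ | ⟨h1, h2⟩
      · exact Or.inl ⟨(address_eq_of_eq h1).trans hti, (address_eq_of_eq h2).trans hci⟩
      · exact Or.inr ⟨(address_eq_of_eq h1).trans hci, (address_eq_of_eq h2).trans hti⟩
    rcases lt_or_gt_of_ne hne with hlt | hlt
    · exact ⟨j, i, hlt, by omega, huj, hui⟩
    · exact ⟨i, j, hlt, by omega, hui, huj⟩

/-- A doubled walk is an exploration of a labelled plane tree. -/
theorem exists_labelled_exploration {L : ℕ} {w : Fin (L + 1) → α}
    (hw : IsDoubled (extendWalk w) L) :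
    ∃ (T : PlaneTree) (l : T.verts ↪ α), ∃ a ∈ explorations T L, w = fun i => l (a i) := by
  classical
  set v := extendWalk w with hv
  have hex := isExploration_address hw
  have hu : ∀ u : (visitTree v L).verts, ∃ i ≤ L, address v i = u := fun u =>
    hex.visits u.1 u.2
  choose t ht1 ht2 using hu
  refine ⟨visitTree v L, ⟨fun u => v (t u), fun x y hxy => ?_⟩,
    fun i => ⟨address v i, hex.mem i (by omega)⟩, ?_, ?_⟩
  · exact Subtype.ext (by rw [← ht2 x, ← ht2 y]; exact address_eq_of_eq hxy)
  · refine Finset.mem_filter.2 ⟨Finset.mem_univ _, ?_⟩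
    have he : ∀ i ≤ L, (extendWalk (fun i : Fin (L + 1) =>
        (⟨address v i, hex.mem i (by omega)⟩ : (visitTree v L).verts)) i).1 = address v i := by
      intro i hi
      rw [extendWalk_of_le _ hi]
    refine ⟨?_, ?_, ?_, ?_, ?_⟩
    · rw [he 0 (by omega)]; exact hex.zero
    · intro i hi; rw [he i hi]; exact hex.mem i hi
    · intro u hu
      obtain ⟨i, hi, hiu⟩ := hex.visits u hu
      exact ⟨i, hi, by rw [he i hi, hiu]⟩
    · intro i hi hnew
      rw [he i hi.le, he (i + 1) hi]
      obtain ⟨m, hm, hm'⟩ := hex.enters i hi fun j hj => by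
        have := hnew j hj
        rwa [he j (by omega), he (i + 1) hi] at this
      refine ⟨m, hm, fun m' hlt => ?_⟩
      obtain ⟨j, hj, hj'⟩ := hm' m' hlt
      exact ⟨j, hj, by rw [he j (by omega), hj']⟩
    · intro c hc hc'
      obtain ⟨i, j, hij, hj, h1, h2⟩ := hex.twice c hc hc'
      refine ⟨i, j, hij, hj, ?_, ?_⟩
      · rwa [UsesEdge, he i (by omega), he (i + 1) (by omega)]
      · rwa [UsesEdge, he j (by omega), he (j + 1) (by omega)]
  · funext i
    have h1 := eq_of_address_eq v L i.1 (by omega)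
      (t ⟨address v i, hex.mem i (by omega)⟩) (ht1 _)
      (ht2 ⟨address v i, hex.mem i (by omega)⟩).symm
    show w i = v (t _)
    rw [← h1, hv, extendWalk_of_le w (by omega)]

end Addresses

/-! ### Traces of powers as sums over walks, and operator norm bounds. -/

section Matrices

theorem pow_apply_eq_sum_walks {N : ℕ} (X : Matrix (Fin N) (Fin N) ℝ) (L : ℕ) (x y : Fin N) :
    (X ^ L) x y = ∑ w : Fin (L + 1) → Fin N, if w 0 = x ∧ w (Fin.last L) = y then
      ∏ i : Fin L, X (w i.castSucc) (w i.succ) else 0 := by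
  induction L generalizing x with
  | zero =>
    rw [← (Equiv.funUnique (Fin 1) (Fin N)).symm.sum_comp]
    by_cases h : x = y
    · subst h
      simp
    · rw [pow_zero, Matrix.one_apply_ne h, eq_comm]
      refine Finset.sum_eq_zero fun z _ => if_neg ?_
      rintro ⟨h1, h2⟩
      exact h (h1.symm.trans h2)
  | succ L ih =>
    have hcons : ∀ (z : Fin N) (w : Fin (L + 1) → Fin N),
        (if (Fin.cons z w : Fin (L + 2) → Fin N) 0 = x ∧
            (Fin.cons z w : Fin (L + 2) → Fin N) (Fin.last (L + 1)) = y then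
          ∏ i : Fin (L + 1), X ((Fin.cons z w : Fin (L + 2) → Fin N) i.castSucc)
            ((Fin.cons z w : Fin (L + 2) → Fin N) i.succ) else 0) =
        if z = x ∧ w (Fin.last L) = y then
          X z (w 0) * ∏ i : Fin L, X (w i.castSucc) (w i.succ) else 0 := by
      intro z w
      rw [← Fin.succ_last, Fin.prod_univ_succ]
      simp only [Fin.cons_zero, Fin.cons_succ, Fin.castSucc_zero, ← Fin.succ_castSucc]
    rw [pow_succ', Matrix.mul_apply, ← (Fin.consEquiv fun _ : Fin (L + 2) => Fin N).sum_comp,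
      Fintype.sum_prod_type]
    refine Eq.trans ?_ (Finset.sum_congr rfl fun z _ =>
      Finset.sum_congr rfl fun w _ => (hcons z w).symm)
    simp only [ih, Finset.mul_sum]
    conv_lhs => rw [Finset.sum_comm]
    conv_rhs => rw [Finset.sum_comm]
    refine Finset.sum_congr rfl fun w _ => ?_
    rw [Finset.sum_eq_single (w 0), Finset.sum_eq_single x]
    · simp
    · intro z _ hz
      rw [if_neg fun h => hz h.1]
    · simp
    · intro z _ hz
      rw [if_neg fun h => hz h.1.symm, mul_zero]
    · simp

theorem trace_pow_eq_sum_walks {N : ℕ} (X : Matrix (Fin N) (Fin N) ℝ) (L : ℕ) :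
    (X ^ L).trace = ∑ w : Fin (L + 1) → Fin N with w 0 = w (Fin.last L),
      ∏ i : Fin L, X (w i.castSucc) (w i.succ) := by
  rw [Matrix.trace, Finset.sum_filter]
  simp only [Matrix.diag_apply, pow_apply_eq_sum_walks]
  rw [Finset.sum_comm]
  refine Finset.sum_congr rfl fun w _ => ?_
  rw [Finset.sum_eq_single (w 0)]
  · simp [eq_comm]
  · intro z _ hz
    rw [if_neg fun h => hz h.1.symm]
  · simp

theorem opNorm_nonneg {N : ℕ} (M : Matrix (Fin N) (Fin N) ℝ) : 0 ≤ opNorm M := norm_nonneg _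

theorem opNorm_add_le {N : ℕ} (M M' : Matrix (Fin N) (Fin N) ℝ) :
    opNorm (M + M') ≤ opNorm M + opNorm M' := by
  rw [opNorm, map_add]
  exact norm_add_le _ _

/-- The operator norm is controlled by quadratic estimates in coordinates. -/
theorem opNorm_le_of_sum_sq_le {N : ℕ} (M : Matrix (Fin N) (Fin N) ℝ) {c : ℝ} (hc : 0 ≤ c)
    (h : ∀ x : Fin N → ℝ, ∑ i, (∑ j, M i j * x j) ^ 2 ≤ c ^ 2 * ∑ j, x j ^ 2) : opNorm M ≤ c := by
  refine ContinuousLinearMap.opNorm_le_bound _ hc fun x => ?_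
  refine abs_le_of_sq_le_sq' ?_ (by positivity) |>.2
  rw [mul_pow, EuclideanSpace.real_norm_sq_eq, EuclideanSpace.real_norm_sq_eq]
  simpa [Matrix.mulVec, dotProduct] using h x

theorem opNorm_sq_le_sum_sq {N : ℕ} (M : Matrix (Fin N) (Fin N) ℝ) :
    opNorm M ^ 2 ≤ ∑ i, ∑ j, M i j ^ 2 := by
  have h0 : 0 ≤ ∑ i, ∑ j, M i j ^ 2 := by positivity
  have h : opNorm M ≤ √(∑ i, ∑ j, M i j ^ 2) := by
    refine opNorm_le_of_sum_sq_le M (Real.sqrt_nonneg _) fun x => ?_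
    rw [Real.sq_sqrt h0, Finset.sum_mul]
    exact Finset.sum_le_sum fun i _ => Finset.sum_mul_sq_le_sq_mul_sq _ _ _
  calc opNorm M ^ 2 ≤ √(∑ i, ∑ j, M i j ^ 2) ^ 2 := pow_le_pow_left₀ (opNorm_nonneg M) h 2
    _ = _ := Real.sq_sqrt h0

theorem opNorm_le_mul_of_abs_le {N : ℕ} (M : Matrix (Fin N) (Fin N) ℝ) {c : ℝ} (hc : 0 ≤ c)
    (h : ∀ i j, |M i j| ≤ c) : opNorm M ≤ N * c := by
  refine abs_le_of_sq_le_sq' ?_ (by positivity) |>.2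
  calc opNorm M ^ 2 ≤ ∑ i, ∑ j, M i j ^ 2 := opNorm_sq_le_sum_sq M
    _ ≤ ∑ _i : Fin N, ∑ _j : Fin N, c ^ 2 :=
        Finset.sum_le_sum fun i _ => Finset.sum_le_sum fun j _ => sq_le_sq' (abs_le.1 (h i j)).1
          (abs_le.1 (h i j)).2
    _ = (N * c) ^ 2 := by simp; ring

/-- The operator norm of a matrix with at most one nonzero entry in each row and column. -/
theorem opNorm_le_of_sparse {N : ℕ} (M : Matrix (Fin N) (Fin N) ℝ) {c : ℝ} (hc : 0 ≤ c)
    (h : ∀ i j, |M i j| ≤ c) (hsymm : M.IsSymm)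
    (hrow : ∀ i j j', M i j ≠ 0 → M i j' ≠ 0 → j = j') : opNorm M ≤ c := by
  have hsq : ∀ (i : Fin N) (x : Fin N → ℝ), (∀ j j', M i j ≠ 0 → M i j' ≠ 0 → j = j') →
      (∑ j, M i j * x j) ^ 2 = ∑ j, M i j ^ 2 * x j ^ 2 := by
    intro i x hi
    by_cases h0 : ∃ j, M i j ≠ 0
    · obtain ⟨j, hj⟩ := h0
      have hz : ∀ j', j' ≠ j → M i j' = 0 := fun j' hne => by
        by_contra hne'
        exact hne (hi _ _ hne' hj)
      rw [Finset.sum_eq_single j, Finset.sum_eq_single j, mul_pow]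
      all_goals simp +contextual [hz]
    · push Not at h0
      simp [h0]
  refine opNorm_le_of_sum_sq_le M hc fun x => ?_
  have hcol : ∀ j, ∑ i, M i j ^ 2 ≤ c ^ 2 := by
    intro j
    -- With `x = 1`, the sum of squares in row `j` is the square of the row sum, which has at most
    -- one nonzero term; by symmetry it is also the sum over column `j`.
    have h1 := hsq j 1 (hrow j)
    have h2 : ∑ i, M i j ^ 2 = ∑ i, M j i ^ 2 * (1 : Fin N → ℝ) i ^ 2 :=
      Finset.sum_congr rfl fun i _ => by rw [← hsymm.apply i j]; simp
    rw [h2, ← h1]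
    refine sq_le_sq' (abs_le.1 ?_).1 (abs_le.1 ?_).2 <;>
    · by_cases h0 : ∃ i, M j i ≠ 0
      · obtain ⟨i, hi⟩ := h0
        rw [Finset.sum_eq_single i]
        · simpa using h j i
        · intro i' _ hne
          by_contra hne'
          exact hne (hrow j _ _ (left_ne_zero_of_mul hne') hi)
        · simp
      · push Not at h0
        simpa [h0] using hc
  calc ∑ i, (∑ j, M i j * x j) ^ 2 = ∑ i, ∑ j, M i j ^ 2 * x j ^ 2 :=
        Finset.sum_congr rfl fun i _ => hsq i x (hrow i)
    _ = ∑ j, (∑ i, M i j ^ 2) * x j ^ 2 := by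
        rw [Finset.sum_comm]
        exact Finset.sum_congr rfl fun j _ => by rw [Finset.sum_mul]
    _ ≤ ∑ j, c ^ 2 * x j ^ 2 :=
        Finset.sum_le_sum fun j _ => mul_le_mul_of_nonneg_right (hcol j) (sq_nonneg _)
    _ = c ^ 2 * ∑ j, x j ^ 2 := by rw [Finset.mul_sum]

/-- The C*-identity gives equality for the exponent $2^k\ge k$; splitting off $x^{2^k-k}$ and
cancelling its norm bound leaves the exponent $k$. -/
theorem IsSelfAdjoint.norm_pow_le {E : Type*} [NormedRing E] [StarRing E] [CStarRing E]
    [NormOneClass E] {x : E} (hx : IsSelfAdjoint x) (k : ℕ) : ‖x‖ ^ k ≤ ‖x ^ k‖ := by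
  rcases (norm_nonneg x).eq_or_lt with h0 | hpos
  · rcases Nat.eq_zero_or_pos k with rfl | hk
    · simp
    · rw [← h0, zero_pow hk.ne']
      exact norm_nonneg _
  have hk : k ≤ 2 ^ k := Nat.lt_two_pow_self.le
  have h1 := hx.norm_pow_two_pow k
  have h2 : ‖x‖ ^ k * ‖x‖ ^ (2 ^ k - k) ≤ ‖x ^ k‖ * ‖x‖ ^ (2 ^ k - k) := by
    rw [← pow_add, Nat.add_sub_cancel' hk, ← h1]
    calc ‖x ^ 2 ^ k‖ = ‖x ^ k * x ^ (2 ^ k - k)‖ := by rw [← pow_add, Nat.add_sub_cancel' hk]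
      _ ≤ ‖x ^ k‖ * ‖x ^ (2 ^ k - k)‖ := norm_mul_le _ _
      _ ≤ _ := mul_le_mul_of_nonneg_left (_root_.norm_pow_le _ _) (norm_nonneg _)
  exact le_of_mul_le_mul_right h2 (pow_pos hpos _)

/-- The trace is the squared Hilbert–Schmidt norm of `X ^ k`, so no eigenvalues are needed. -/
theorem opNorm_pow_le_trace {N : ℕ} [NeZero N] {X : Matrix (Fin N) (Fin N) ℝ} (hX : X.IsSymm)
    (k : ℕ) : opNorm X ^ (2 * k) ≤ (X ^ (2 * k)).trace := by
  have hself : IsSelfAdjoint (Matrix.toEuclideanCLM (n := Fin N) (𝕜 := ℝ) X) := by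
    rw [isSelfAdjoint_iff, ← map_star, Matrix.star_eq_conjTranspose,
      Matrix.conjTranspose_eq_transpose_of_trivial, hX.eq]
  have h1 : opNorm X ^ k ≤ opNorm (X ^ k) := by
    rw [opNorm, opNorm, map_pow]
    exact hself.norm_pow_le k
  have hXk : (X ^ k).IsSymm := hX.pow k
  calc opNorm X ^ (2 * k) = (opNorm X ^ k) ^ 2 := by rw [mul_comm, pow_mul]
    _ ≤ opNorm (X ^ k) ^ 2 := pow_le_pow_left₀ (pow_nonneg (opNorm_nonneg X) k) h1 2
    _ ≤ ∑ i, ∑ j, (X ^ k) i j ^ 2 := opNorm_sq_le_sum_sq _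
    _ = (X ^ (2 * k)).trace := by
        rw [two_mul, pow_add, Matrix.trace]
        simp only [Matrix.diag_apply, Matrix.mul_apply]
        refine Finset.sum_congr rfl fun i _ => Finset.sum_congr rfl fun j _ => ?_
        rw [hXk.apply i j, sq]

end Matrices

/-! ### The moment method for bounded entries. -/

section BoundedEntries

variable {Ω : Type*} [MeasurableSpace Ω]

/-- A symmetric random matrix with independent centered entries which are bounded by `B` and have
variances at most `s`. -/
structure IsBoundedSymm (P : Measure Ω) {N : ℕ} (X : Ω → Matrix (Fin N) (Fin N) ℝ)
    (s : Fin N → Fin N → ℝ) (B : ℝ) : Prop where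
  measurable : ∀ i j, Measurable fun ω => X ω i j
  isSymm : ∀ ω, (X ω).IsSymm
  indep : iIndepFun (fun (p : {p : Fin N × Fin N // p.1 ≤ p.2}) ω => X ω p.1.1 p.1.2) P
  pos : 0 < B
  bound : ∀ ω i j, |X ω i j| ≤ B
  mean_zero : ∀ i j, ∫ ω, X ω i j ∂P = 0
  sq_le : ∀ i j, ∫ ω, X ω i j ^ 2 ∂P ≤ s i j

/-- The pair of `i` and `j`, sorted. -/
def sortedPair {N : ℕ} (i j : Fin N) : {p : Fin N × Fin N // p.1 ≤ p.2} :=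
  ⟨(min i j, max i j), min_le_max⟩

theorem sortedPair_comm {N : ℕ} (i j : Fin N) : sortedPair i j = sortedPair j i := by
  simp only [sortedPair, min_comm, max_comm]

theorem sortedPair_eq_iff {N : ℕ} {i j i' j' : Fin N} :
    sortedPair i j = sortedPair i' j' ↔ (i = i' ∧ j = j') ∨ (i = j' ∧ j = i') := by
  constructor
  · intro h
    simp only [sortedPair, Subtype.mk.injEq, Prod.mk.injEq, Fin.ext_iff, Fin.coe_min,
      Fin.coe_max] at h
    simp only [Fin.ext_iff]
    omega
  · rintro (⟨rfl, rfl⟩ | ⟨rfl, rfl⟩)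
    · rfl
    · exact sortedPair_comm _ _

theorem apply_sortedPair {N : ℕ} {M : Matrix (Fin N) (Fin N) ℝ} (hM : M.IsSymm) (i j : Fin N) :
    M (sortedPair i j).1.1 (sortedPair i j).1.2 = M i j := by
  rcases le_total i j with h | h
  · simp [sortedPair, h]
  · simp [sortedPair, h, hM.apply]

/-- The number of the first `L` steps of the walk `v` that run along the pair `p`. -/
def pairCount {N : ℕ} (v : ℕ → Fin N) (L : ℕ) (p : {p : Fin N × Fin N // p.1 ≤ p.2}) : ℕ :=
  ((Finset.range L).filter fun i => sortedPair (v i) (v (i + 1)) = p).card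

theorem sum_pairCount {N : ℕ} (v : ℕ → Fin N) (L : ℕ) : ∑ p, pairCount v L p = L := by
  simp only [pairCount]
  rw [← Finset.card_eq_sum_card_fiberwise fun _ _ => Finset.mem_univ _, Finset.card_range]

theorem trace_pow_eq_sum_extendWalk {N : ℕ} (X : Matrix (Fin N) (Fin N) ℝ) (L : ℕ) : (X ^ L).trace =
    ∑ w : Fin (L + 1) → Fin N with w 0 = w (Fin.last L),
      ∏ i ∈ Finset.range L, X (extendWalk w i) (extendWalk w (i + 1)) := by
  rw [trace_pow_eq_sum_walks]
  refine Finset.sum_congr rfl fun w _ => ?_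
  rw [Finset.prod_range]
  refine Finset.prod_congr rfl fun i _ => ?_
  rw [extendWalk_of_le w i.2.le, extendWalk_of_le w i.2]
  rfl

theorem PlaneTree.mem_withEdges {T : PlaneTree} {n : ℕ} :
    T ∈ PlaneTree.withEdges n ↔ T.verts.card = n + 1 := by
  simp [PlaneTree.withEdges]

namespace IsBoundedSymm

variable {P : Measure Ω} {N : ℕ} {X : Ω → Matrix (Fin N) (Fin N) ℝ} {s : Fin N → Fin N → ℝ} {B : ℝ}

/-- Steps are grouped by the unordered pair they run along; different pairs are independent. -/
theorem integral_prod_walk (hX : IsBoundedSymm P X s B) (v : ℕ → Fin N) (L : ℕ) :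
    ∫ ω, ∏ i ∈ Finset.range L, X ω (v i) (v (i + 1)) ∂P =
      ∏ p : {p : Fin N × Fin N // p.1 ≤ p.2}, ∫ ω, X ω p.1.1 p.1.2 ^ pairCount v L p ∂P := by
  rw [← hX.indep.integral_fun_prod_comp (f := fun p x => x ^ pairCount v L p)
    (fun p => (hX.measurable _ _).aemeasurable) (fun p => by fun_prop)]
  congr 1
  funext ω
  rw [← Finset.prod_fiberwise _ (fun i => sortedPair (v i) (v (i + 1)))]
  refine Finset.prod_congr rfl fun p _ => ?_
  rw [pairCount, ← Finset.prod_const]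
  refine Finset.prod_congr rfl fun i hi => ?_
  rw [← (Finset.mem_filter.1 hi).2, apply_sortedPair (hX.isSymm ω)]

/-- A step without a partner contributes the mean of its entry as a factor. -/
theorem integral_prod_eq_zero (hX : IsBoundedSymm P X s B) {v : ℕ → Fin N} {L : ℕ}
    (hv : ¬ IsDoubled v L) : ∫ ω, ∏ i ∈ Finset.range L, X ω (v i) (v (i + 1)) ∂P = 0 := by
  rw [IsDoubled] at hv
  push Not at hv
  obtain ⟨i, hi, hij⟩ := hv
  have h1 : pairCount v L (sortedPair (v i) (v (i + 1))) = 1 := by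
    rw [pairCount, Finset.card_eq_one]
    refine ⟨i, Finset.ext fun j => ?_⟩
    simp only [Finset.mem_filter, Finset.mem_range, Finset.mem_singleton]
    constructor
    · rintro ⟨hj, hji⟩
      by_contra hne
      rcases sortedPair_eq_iff.1 hji with h | h
      · exact (hij j hj hne).1 h.1 h.2
      · exact (hij j hj hne).2 h.1 h.2
    · rintro rfl
      exact ⟨hi, rfl⟩
  rw [hX.integral_prod_walk, Finset.prod_eq_zero (Finset.mem_univ (sortedPair (v i) (v (i + 1))))]
  simp only [h1, pow_one, hX.mean_zero]

theorem s_nonneg (hX : IsBoundedSymm P X s B) (i j : Fin N) : 0 ≤ s i j :=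
  (integral_nonneg fun _ => sq_nonneg _).trans (hX.sq_le i j)

variable [IsProbabilityMeasure P]

theorem abs_integral_pow_le (hX : IsBoundedSymm P X s B) (i j : Fin N) (m : ℕ) :
    |∫ ω, X ω i j ^ m ∂P| ≤ B ^ m := by
  have := norm_integral_le_of_norm_le_const (μ := P) (f := fun ω => X ω i j ^ m) (C := B ^ m)
    (Eventually.of_forall fun ω => by
      rw [Real.norm_eq_abs, abs_pow]
      exact pow_le_pow_left₀ (abs_nonneg _) (hX.bound ω i j) m)
  simpa using this

theorem integrable_sq (hX : IsBoundedSymm P X s B) (i j : Fin N) :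
    Integrable (fun ω => X ω i j ^ 2) P :=
  Integrable.of_bound ((hX.measurable i j).pow_const 2).aestronglyMeasurable (B ^ 2)
    (Eventually.of_forall fun ω => by
      rw [Real.norm_eq_abs, abs_pow]
      exact pow_le_pow_left₀ (abs_nonneg _) (hX.bound ω i j) 2)

theorem abs_integral_pow_le_of_two_le (hX : IsBoundedSymm P X s B) (i j : Fin N) {m : ℕ}
    (hm : 2 ≤ m) : |∫ ω, X ω i j ^ m ∂P| ≤ B ^ m * (s i j / B ^ 2) := by
  obtain ⟨n, rfl⟩ := Nat.exists_eq_add_of_le hm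
  calc |∫ ω, X ω i j ^ (2 + n) ∂P| ≤ ∫ ω, X ω i j ^ 2 * B ^ n ∂P := by
        rw [← Real.norm_eq_abs]
        refine norm_integral_le_of_norm_le ((hX.integrable_sq i j).mul_const _)
          (Eventually.of_forall fun ω => ?_)
        rw [Real.norm_eq_abs, pow_add, abs_mul, abs_pow, abs_pow, sq_abs]
        exact mul_le_mul_of_nonneg_left
          (pow_le_pow_left₀ (abs_nonneg _) (hX.bound ω i j) n) (sq_nonneg _)
    _ = (∫ ω, X ω i j ^ 2 ∂P) * B ^ n := integral_mul_const _ _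
    _ ≤ s i j * B ^ n := mul_le_mul_of_nonneg_right (hX.sq_le i j) (pow_nonneg hX.pos.le n)
    _ = B ^ (2 + n) * (s i j / B ^ 2) := by
        have := hX.pos.ne'
        field_simp
        ring

/-- Injective labels send distinct tree edges to distinct pairs, each used at least twice. Two of
these uses are paid for by the variance and every remaining step by `B`. -/
theorem abs_integral_prod_le (hX : IsBoundedSymm P X s B) {T : PlaneTree} {L : ℕ}
    (l : T.verts ↪ Fin N) {a : Fin (L + 1) → T.verts} (ha : a ∈ explorations T L) :
    |∫ ω, ∏ i ∈ Finset.range L, X ω (l (extendWalk a i)) (l (extendWalk a (i + 1))) ∂P| ≤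
      B ^ (L - 2 * (T.verts.card - 1)) *
        ∏ u : T.verts with u ≠ T.root, s (l (T.parent u)) (l u) := by
  classical
  have hex := (Finset.mem_filter.1 ha).2
  have hroot : ∀ u : T.verts, u ≠ T.root → u.1 ≠ [] := fun u hu h => hu (Subtype.ext h)
  set v : ℕ → Fin N := fun i => l (extendWalk a i) with hv
  set E : Finset T.verts := Finset.univ.filter fun u => u ≠ T.root with hE
  set e : T.verts → {p : Fin N × Fin N // p.1 ≤ p.2} := fun u => sortedPair (l (T.parent u)) (l u)
    with he
  set s' : {p : Fin N × Fin N // p.1 ≤ p.2} → ℝ := fun p => ∫ ω, X ω p.1.1 p.1.2 ^ 2 ∂P with hs'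
  -- Sorting a pair may swap its entries and `s` need not be symmetric, so the exact second moments
  -- are used until the last step.
  have hX' : IsBoundedSymm P X (fun i j => ∫ ω, X ω i j ^ 2 ∂P) B :=
    ⟨hX.measurable, hX.isSymm, hX.indep, hX.pos, hX.bound, hX.mean_zero, fun _ _ => le_rfl⟩
  have hinj : Set.InjOn e E := by
    intro u hu u' hu' h
    rcases sortedPair_eq_iff.1 h with ⟨-, h2⟩ | ⟨h1, h2⟩
    · exact l.injective h2
    · have e1 := congrArg (fun x : T.verts => x.1.length) (l.injective h1)
      have e2 := congrArg (fun x : T.verts => x.1.length) (l.injective h2)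
      have := List.length_pos_iff.2 (hroot u (Finset.mem_filter.1 hu).2)
      simp only [PlaneTree.parent, List.length_tail] at e1 e2
      omega
  have hcount : ∀ u ∈ E, 2 ≤ pairCount v L (e u) := by
    intro u hu
    obtain ⟨i, j, hij, hj, h1, h2⟩ := hex.twice u.1 u.2 (hroot u (Finset.mem_filter.1 hu).2)
    have hstep : ∀ i, UsesEdge (fun i => (extendWalk a i).1) u.1 i →
        sortedPair (v i) (v (i + 1)) = e u := by
      rintro i (⟨h1, h2⟩ | ⟨h1, h2⟩)
      · have e1 : extendWalk a i = T.parent u := Subtype.ext h1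
        have e2 : extendWalk a (i + 1) = u := Subtype.ext h2
        simp only [hv, he, e1, e2]
      · have e1 : extendWalk a i = u := Subtype.ext h1
        have e2 : extendWalk a (i + 1) = T.parent u := Subtype.ext h2
        simp only [hv, he, e1, e2, sortedPair_comm]
    exact Finset.one_lt_card.2 ⟨i, Finset.mem_filter.2 ⟨Finset.mem_range.2 (by omega), hstep i h1⟩,
      j, Finset.mem_filter.2 ⟨Finset.mem_range.2 hj, hstep j h2⟩, hij.ne⟩
  have hcard : E.card = T.verts.card - 1 := by
    have : E = Finset.univ.erase T.root := by ext u; simp [hE]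
    rw [this, Finset.card_erase_of_mem (Finset.mem_univ _)]
    simp
  rw [hX.integral_prod_walk v L, Finset.abs_prod]
  calc ∏ p, |∫ ω, X ω p.1.1 p.1.2 ^ pairCount v L p ∂P|
      ≤ ∏ p, B ^ pairCount v L p * (if p ∈ E.image e then s' p / B ^ 2 else 1) := by
        refine Finset.prod_le_prod (fun _ _ => abs_nonneg _) fun p _ => ?_
        split_ifs with hp
        · obtain ⟨u, hu, rfl⟩ := Finset.mem_image.1 hp
          exact hX'.abs_integral_pow_le_of_two_le _ _ (hcount u hu)
        · rw [mul_one]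
          exact hX.abs_integral_pow_le _ _ _
    _ = B ^ L * ∏ u ∈ E, s' (e u) / B ^ 2 := by
        rw [Finset.prod_mul_distrib, Finset.prod_pow_eq_pow_sum, sum_pairCount,
          Finset.prod_ite_mem, Finset.univ_inter, Finset.prod_image hinj]
    _ = B ^ (L - 2 * (T.verts.card - 1)) * ∏ u ∈ E, s' (e u) := by
        have h2 := hex.two_mul_le
        have hB := hX.pos.ne'
        rw [Finset.prod_div_distrib, Finset.prod_const, hcard, ← pow_mul]
        rw [show B ^ L = B ^ (L - 2 * (T.verts.card - 1)) * B ^ (2 * (T.verts.card - 1)) by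
          rw [← pow_add, Nat.sub_add_cancel h2]]
        field_simp
    _ ≤ B ^ (L - 2 * (T.verts.card - 1)) * ∏ u ∈ E, s (l (T.parent u)) (l u) := by
        refine mul_le_mul_of_nonneg_left ?_ (pow_nonneg hX.pos.le _)
        refine Finset.prod_le_prod (fun _ _ => integral_nonneg fun _ => sq_nonneg _) fun u _ => ?_
        refine le_trans (le_of_eq ?_) (hX.sq_le (l (T.parent u)) (l u))
        simp only [hs', he]
        congr 1
        funext ω
        rw [apply_sortedPair (hX.isSymm ω)]

theorem integrable_prod_walk (hX : IsBoundedSymm P X s B) (v : ℕ → Fin N) (L : ℕ) :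
    Integrable (fun ω => ∏ i ∈ Finset.range L, X ω (v i) (v (i + 1))) P := by
  refine Integrable.of_bound (C := B ^ L) ?_ (Eventually.of_forall fun ω => ?_)
  · exact (Finset.measurable_fun_prod _ fun i _ => hX.measurable _ _).aestronglyMeasurable
  · rw [Real.norm_eq_abs, Finset.abs_prod]
    calc ∏ i ∈ Finset.range L, |X ω (v i) (v (i + 1))| ≤ ∏ _i ∈ Finset.range L, B :=
          Finset.prod_le_prod (fun _ _ => abs_nonneg _) fun _ _ => hX.bound _ _ _
      _ = B ^ L := by simp

theorem integrable_trace_pow (hX : IsBoundedSymm P X s B) (L : ℕ) :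
    Integrable (fun ω => (X ω ^ L).trace) P := by
  simp only [trace_pow_eq_sum_extendWalk]
  exact integrable_finsetSum _ fun w _ => hX.integrable_prod_walk _ _

/-- Doubled walks are covered by triples of a tree, a labelling and an exploration, and the trees
are sorted by their number `n ≤ L / 2` of edges. Covering a walk repeatedly is harmless, as absolute
values are summed. -/
theorem integral_trace_pow_le (hX : IsBoundedSymm P X s B) (L : ℕ) :
    ∫ ω, (X ω ^ L).trace ∂P ≤ ∑ n ∈ Finset.range (L / 2 + 1),
      ((L * (n + 1) + 1 : ℕ) : ℝ) ^ (2 * (L - 2 * n)) * B ^ (L - 2 * n) * treeSum s n := by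
  classical
  set E : (Fin (L + 1) → Fin N) → ℝ := fun w =>
    |∫ ω, ∏ i ∈ Finset.range L, X ω (extendWalk w i) (extendWalk w (i + 1)) ∂P| with hE
  set S : Finset (Σ T : PlaneTree, (T.verts ↪ Fin N) × (Fin (L + 1) → T.verts)) :=
    ((Finset.range (L / 2 + 1)).biUnion PlaneTree.withEdges).sigma
      fun T => Finset.univ ×ˢ explorations T L with hS
  set g : (Σ T : PlaneTree, (T.verts ↪ Fin N) × (Fin (L + 1) → T.verts)) → Fin (L + 1) → Fin N :=
    fun x i => x.2.1 (x.2.2 i) with hg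
  have hdisj : (↑(Finset.range (L / 2 + 1)) : Set ℕ).PairwiseDisjoint PlaneTree.withEdges := by
    intro m _ n _ hmn
    refine Finset.disjoint_left.2 fun T hm hn => hmn ?_
    rw [PlaneTree.mem_withEdges] at hm hn
    omega
  have hsub : (Finset.univ.filter fun w : Fin (L + 1) → Fin N => IsDoubled (extendWalk w) L) ⊆
      S.image g := by
    intro w hw
    obtain ⟨T, l, a, ha, hwa⟩ := exists_labelled_exploration (Finset.mem_filter.1 hw).2
    have h2 := (Finset.mem_filter.1 ha).2.two_mul_le
    have h1 : 0 < T.verts.card := Finset.card_pos.2 ⟨_, T.root_mem⟩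
    refine Finset.mem_image.2 ⟨⟨T, l, a⟩, Finset.mem_sigma.2 ⟨?_, ?_⟩, hwa.symm⟩
    · refine Finset.mem_biUnion.2 ⟨T.verts.card - 1, Finset.mem_range.2 (by omega), ?_⟩
      rw [PlaneTree.mem_withEdges]
      exact (Nat.sub_add_cancel h1).symm
    · exact Finset.mem_product.2 ⟨Finset.mem_univ _, ha⟩
  calc ∫ ω, (X ω ^ L).trace ∂P
      = ∑ w : Fin (L + 1) → Fin N with w 0 = w (Fin.last L),
        ∫ ω, ∏ i ∈ Finset.range L, X ω (extendWalk w i) (extendWalk w (i + 1)) ∂P := by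
        simp only [trace_pow_eq_sum_extendWalk]
        exact integral_finsetSum _ fun w _ => hX.integrable_prod_walk _ _
    _ ≤ ∑ w : Fin (L + 1) → Fin N with w 0 = w (Fin.last L), E w :=
        Finset.sum_le_sum fun w _ => le_abs_self _
    -- That the walk is closed is given up here: the bound on explorations does not need it.
    _ ≤ ∑ w : Fin (L + 1) → Fin N, E w :=
        Finset.sum_le_sum_of_subset_of_nonneg (Finset.filter_subset _ _) fun _ _ _ => abs_nonneg _
    _ = ∑ w : Fin (L + 1) → Fin N with IsDoubled (extendWalk w) L, E w := by
        rw [Finset.sum_filter]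
        refine Finset.sum_congr rfl fun w _ => ?_
        split_ifs with hw
        · rfl
        · rw [hE]
          simp only [hX.integral_prod_eq_zero hw, abs_zero]
    _ ≤ ∑ w ∈ S.image g, E w :=
        Finset.sum_le_sum_of_subset_of_nonneg hsub fun _ _ _ => abs_nonneg _
    _ ≤ ∑ x ∈ S, E (g x) := Finset.sum_image_le_of_nonneg fun _ _ => abs_nonneg _
    _ = ∑ n ∈ Finset.range (L / 2 + 1), ∑ T ∈ PlaneTree.withEdges n, ∑ l : T.verts ↪ Fin N,
          ∑ a ∈ explorations T L, E (fun i => l (a i)) := by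
        rw [Finset.sum_sigma, Finset.sum_biUnion hdisj]
        refine Finset.sum_congr rfl fun n _ => Finset.sum_congr rfl fun T _ => ?_
        rw [Finset.sum_product]
    _ ≤ _ := by
        refine Finset.sum_le_sum fun n hn => ?_
        rw [treeSum, Finset.mul_sum]
        refine Finset.sum_le_sum fun T hT => ?_
        rw [Finset.mul_sum]
        refine Finset.sum_le_sum fun l _ => ?_
        rw [PlaneTree.mem_withEdges] at hT
        have hn2 : 2 * n ≤ L := by
          have := Finset.mem_range.1 hn
          omega
        have hnn : 0 ≤ B ^ (L - 2 * n) *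
            ∏ u : T.verts with u ≠ T.root, s (l (T.parent u)) (l u) :=
          mul_nonneg (pow_nonneg hX.pos.le _) (Finset.prod_nonneg fun _ _ => hX.s_nonneg _ _)
        calc ∑ a ∈ explorations T L, E (fun i => l (a i))
            ≤ ∑ _a ∈ explorations T L, B ^ (L - 2 * n) *
              ∏ u : T.verts with u ≠ T.root, s (l (T.parent u)) (l u) := by
              refine Finset.sum_le_sum fun a ha => ?_
              have := hX.abs_integral_prod_le l ha
              rwa [hT, Nat.add_sub_cancel] at this
          _ = ((explorations T L).card : ℝ) * (B ^ (L - 2 * n) *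
              ∏ u : T.verts with u ≠ T.root, s (l (T.parent u)) (l u)) := by
              rw [Finset.sum_const, nsmul_eq_mul]
          _ ≤ ((L * (n + 1) + 1 : ℕ) : ℝ) ^ (2 * (L - 2 * n)) * (B ^ (L - 2 * n) *
              ∏ u : T.verts with u ≠ T.root, s (l (T.parent u)) (l u)) := by
              refine mul_le_mul_of_nonneg_right ?_ hnn
              have := card_explorations_le T L (2 * (L - 2 * n)) (by rw [hT]; omega)
              rw [hT] at this
              exact_mod_cast this
          _ = _ := by ring

end IsBoundedSymm

end BoundedEntries

/-! ### From tree sums to a tail bound for the norm. -/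

section TailBound

variable {Ω : Type*} [MeasurableSpace Ω]

/-- Condition $\Sigma(R)$ starts at one edge, but the expansion of the trace also contains the tree
with a single vertex. -/
theorem treeSum_zero_le {N : ℕ} (s : Fin N → Fin N → ℝ) : treeSum s 0 ≤ N := by
  classical
  have hverts : ∀ T ∈ PlaneTree.withEdges 0, T.verts = {[]} := by
    intro T hT
    obtain ⟨x, hx⟩ := Finset.card_eq_one.1 (PlaneTree.mem_withEdges.1 hT)
    have := T.root_mem
    rw [hx, Finset.mem_singleton] at this
    rw [hx, this]
  have hcard : (PlaneTree.withEdges 0).card ≤ 1 := Finset.card_le_one.2 fun S hS T hT =>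
    PlaneTree.ext (by rw [hverts S hS, hverts T hT])
  have hterm : ∀ T ∈ PlaneTree.withEdges 0, ∑ l : T.verts ↪ Fin N,
      ∏ u : T.verts with u ≠ T.root, s (l (T.parent u)) (l u) = N := by
    intro T hT
    have h1 : (Finset.univ.filter fun u : T.verts => u ≠ T.root) = ∅ := by
      refine Finset.filter_eq_empty_iff.2 fun u _ h => h (Subtype.ext ?_)
      have : u.1 ∈ ({[]} : Finset (List ℕ)) := by
        rw [← hverts T hT]
        exact u.2
      exact Finset.mem_singleton.1 this
    have h2 : T.verts.card = 1 := by rw [hverts T hT, Finset.card_singleton]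
    simp only [h1, Finset.prod_empty]
    simp [Fintype.card_embedding_eq, h2]
  rw [treeSum, Finset.sum_congr rfl hterm, Finset.sum_const, nsmul_eq_mul]
  have : ((PlaneTree.withEdges 0).card : ℝ) ≤ 1 := by exact_mod_cast hcard
  nlinarith [(Nat.cast_nonneg N : (0 : ℝ) ≤ N)]

theorem sum_half_pow_sub_le (k : ℕ) : ∑ n ∈ Finset.range (k + 1), (1 / 2 : ℝ) ^ (k - n) ≤ 2 := by
  have h := Finset.sum_range_reflect (fun n => (1 / 2 : ℝ) ^ n) (k + 1)
  simp only [Nat.add_sub_cancel] at h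
  rw [h]
  exact sum_geometric_two_le _

namespace IsBoundedSymm

variable {P : Measure Ω} [IsProbabilityMeasure P] {N : ℕ} {X : Ω → Matrix (Fin N) (Fin N) ℝ}
  {s : Fin N → Fin N → ℝ} {B : ℝ}

/-- Each edge missing from the maximal number `k` costs at most the left side of `hB` and saves `N *
R ^ 2`, so the terms decay geometrically with ratio 1/2 away from `n = k`. -/
theorem integral_trace_pow_le_of_treeSum_le (hX : IsBoundedSymm P X s B) {k : ℕ} {C R : ℝ}
    (hC : 0 ≤ C) (hs : ∀ n ≤ k, treeSum s n ≤ C * (N : ℝ) ^ (n + 1) * R ^ (2 * n))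
    (hB : (2 * (k : ℝ) * (k + 1) + 1) ^ 4 * B ^ 2 ≤ N * R ^ 2 / 2) :
    ∫ ω, (X ω ^ (2 * k)).trace ∂P ≤ 2 * C * (N : ℝ) ^ (k + 1) * R ^ (2 * k) := by
  refine (hX.integral_trace_pow_le (2 * k)).trans ?_
  rw [Nat.mul_div_cancel_left k two_pos]
  have hA : 0 ≤ C * (N : ℝ) ^ (k + 1) * R ^ (2 * k) := by
    rw [pow_mul]
    positivity
  calc _ ≤ ∑ n ∈ Finset.range (k + 1),
        (C * (N : ℝ) ^ (k + 1) * R ^ (2 * k)) * (1 / 2 : ℝ) ^ (k - n) := by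
        refine Finset.sum_le_sum fun n hn => ?_
        have hnk : n ≤ k := Nat.lt_succ_iff.1 (Finset.mem_range.1 hn)
        obtain ⟨d, rfl⟩ := Nat.exists_eq_add_of_le hnk
        have e1 : 2 * (n + d) - 2 * n = 2 * d := by omega
        have e2 : n + d - n = d := by omega
        rw [e1, e2]
        set q : ℝ := ((2 * (n + d) * (n + 1) + 1 : ℕ) : ℝ) with hq
        have hq0 : 0 ≤ q := Nat.cast_nonneg _
        have hqle : q ^ 4 * B ^ 2 ≤ N * R ^ 2 / 2 := by
          refine le_trans (mul_le_mul_of_nonneg_right (pow_le_pow_left₀ hq0 ?_ 4) (sq_nonneg B)) hB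
          rw [hq]
          push_cast
          have hd : (0 : ℝ) ≤ d := Nat.cast_nonneg d
          have hn : (0 : ℝ) ≤ n := Nat.cast_nonneg n
          nlinarith [mul_nonneg hd hn, mul_nonneg hd hd]
        have h0 : 0 ≤ q ^ 4 * B ^ 2 := by positivity
        calc q ^ (2 * (2 * d)) * B ^ (2 * d) * treeSum s n
            = (q ^ 4 * B ^ 2) ^ d * treeSum s n := by
              rw [mul_pow, ← pow_mul, ← pow_mul]
              congr 3
              omega
          _ ≤ (q ^ 4 * B ^ 2) ^ d * (C * (N : ℝ) ^ (n + 1) * R ^ (2 * n)) :=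
              mul_le_mul_of_nonneg_left (hs n hnk) (pow_nonneg h0 d)
          _ ≤ (N * R ^ 2 / 2) ^ d * (C * (N : ℝ) ^ (n + 1) * R ^ (2 * n)) := by
              refine mul_le_mul_of_nonneg_right (pow_le_pow_left₀ h0 hqle d) ?_
              rw [pow_mul]
              positivity
          _ = C * (N : ℝ) ^ (n + d + 1) * R ^ (2 * (n + d)) * (1 / 2) ^ d := by
              rw [div_pow, mul_pow, one_div, inv_pow, ← pow_mul]
              ring
    _ = (C * (N : ℝ) ^ (k + 1) * R ^ (2 * k)) * ∑ n ∈ Finset.range (k + 1),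
        (1 / 2 : ℝ) ^ (k - n) := by rw [Finset.mul_sum]
    _ ≤ (C * (N : ℝ) ^ (k + 1) * R ^ (2 * k)) * 2 :=
        mul_le_mul_of_nonneg_left (sum_half_pow_sub_le k) hA
    _ = _ := by ring

theorem measure_opNorm_ge_le (hX : IsBoundedSymm P X s B) (hN : 0 < N) {k : ℕ} {C R ρ : ℝ}
    (hC : 0 ≤ C) (hρ : 0 < ρ)
    (hs : ∀ n ≤ k, treeSum s n ≤ C * (N : ℝ) ^ (n + 1) * R ^ (2 * n))
    (hB : (2 * (k : ℝ) * (k + 1) + 1) ^ 4 * B ^ 2 ≤ N * R ^ 2 / 2) :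
    P.real {ω | ρ * √(N : ℝ) ≤ opNorm (X ω)} ≤ 2 * C * N * (R / ρ) ^ (2 * k) := by
  have : NeZero N := ⟨hN.ne'⟩
  have hN' : (0 : ℝ) < N := Nat.cast_pos.2 hN
  have hpos : 0 < (ρ * √(N : ℝ)) ^ (2 * k) := by positivity
  have hmarkov := mul_meas_ge_le_integral_of_nonneg (μ := P)
    (f := fun ω => (X ω ^ (2 * k)).trace)
    (Eventually.of_forall fun ω =>
      (pow_nonneg (opNorm_nonneg _) _).trans (opNorm_pow_le_trace (hX.isSymm ω) k))
    (hX.integrable_trace_pow (2 * k)) ((ρ * √(N : ℝ)) ^ (2 * k))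
  have hsub : P.real {ω | ρ * √(N : ℝ) ≤ opNorm (X ω)} ≤
      P.real {ω | (ρ * √(N : ℝ)) ^ (2 * k) ≤ (X ω ^ (2 * k)).trace} := by
    refine measureReal_mono fun ω hω => ?_
    exact (pow_le_pow_left₀ (by positivity) hω _).trans (opNorm_pow_le_trace (hX.isSymm ω) k)
  have h1 := hmarkov.trans (hX.integral_trace_pow_le_of_treeSum_le hC hs hB)
  refine hsub.trans ?_
  rw [← le_div_iff₀' hpos] at h1
  refine h1.trans (le_of_eq ?_)
  rw [mul_pow, pow_mul (√(N : ℝ)), Real.sq_sqrt hN'.le, div_pow]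
  field_simp
  ring

end IsBoundedSymm

end TailBound

/-! ### Truncation, its mean, and the cut-off part. -/

section Truncation

variable {Ω : Type*} [MeasurableSpace Ω]

/-- The number `x`, replaced by `0` if its absolute value is more than `b`. -/
noncomputable def trunc (b x : ℝ) : ℝ := if |x| ≤ b then x else 0

theorem measurable_trunc (b : ℝ) : Measurable (trunc b) :=
  Measurable.ite (measurableSet_le measurable_id.abs measurable_const) measurable_id
    measurable_const

theorem abs_trunc_le {b : ℝ} (hb : 0 ≤ b) (x : ℝ) : |trunc b x| ≤ b := by
  rw [trunc]
  split_ifs with h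
  · exact h
  · simpa using hb

theorem trunc_sq_le (b x : ℝ) : trunc b x ^ 2 ≤ |x| ^ 2 := by
  rw [trunc, sq_abs]
  split_ifs with h
  · exact le_rfl
  · simpa using sq_nonneg x

theorem abs_sub_trunc_le {b : ℝ} (hb : 0 < b) (x : ℝ) : |x - trunc b x| ≤ |x| ^ 4 / b ^ 3 := by
  rw [trunc]
  split_ifs with h
  · rw [sub_self, abs_zero]
    positivity
  · push Not at h
    rw [sub_zero, le_div_iff₀ (by positivity), pow_succ' |x| 3]
    exact mul_le_mul_of_nonneg_left (pow_le_pow_left₀ hb.le h.le 3) (abs_nonneg x)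

theorem abs_sub_trunc_le_abs (b x : ℝ) : |x - trunc b x| ≤ |x| := by
  rw [trunc]
  split_ifs with h
  · rw [sub_self, abs_zero]
    positivity
  · rw [sub_zero]

theorem lt_abs_of_sub_trunc_ne_zero {b x : ℝ} (h : x - trunc b x ≠ 0) : b < |x| := by
  by_contra hle
  exact h (by rw [trunc, if_pos (not_lt.1 hle), sub_self])

/-- The expected values of the truncated entries. -/
noncomputable def truncMean (P : Measure Ω) {N : ℕ} (A : Ω → Matrix (Fin N) (Fin N) ℝ) (b : ℝ) :
    Matrix (Fin N) (Fin N) ℝ :=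
  Matrix.of fun i j => ∫ ω, trunc b (A ω i j) ∂P

/-- The truncated entries, centered. -/
noncomputable def truncCentered (P : Measure Ω) {N : ℕ} (A : Ω → Matrix (Fin N) (Fin N) ℝ) (b : ℝ)
    (ω : Ω) : Matrix (Fin N) (Fin N) ℝ :=
  Matrix.of fun i j => trunc b (A ω i j) - truncMean P A b i j

/-- The part of the matrix that is cut off by the truncation. -/
noncomputable def truncTail {N : ℕ} (A : Ω → Matrix (Fin N) (Fin N) ℝ) (b : ℝ) (ω : Ω) :
    Matrix (Fin N) (Fin N) ℝ :=
  Matrix.of fun i j => A ω i j - trunc b (A ω i j)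

theorem truncation_eq (P : Measure Ω) {N : ℕ} (A : Ω → Matrix (Fin N) (Fin N) ℝ) (b : ℝ) (ω : Ω) :
    A ω = truncCentered P A b ω + truncMean P A b + truncTail A b ω := by
  ext i j
  simp [truncCentered, truncTail]

variable {P : Measure Ω} [IsProbabilityMeasure P] {N : ℕ} {A : Ω → Matrix (Fin N) (Fin N) ℝ} {b : ℝ}

/-- Both truncating and centring can only lower the second moment, so the original variance profile
remains an upper bound. -/
theorem isBoundedSymm_truncCentered (hmeas : ∀ i j, Measurable fun ω => A ω i j)
    (hsymm : ∀ ω, (A ω).IsSymm)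
    (hindep : iIndepFun (fun (p : {p : Fin N × Fin N // p.1 ≤ p.2}) ω => A ω p.1.1 p.1.2) P)
    (hsq : ∀ i j, Integrable (fun ω => |A ω i j| ^ 2) P) (hb : 0 < b) :
    IsBoundedSymm P (truncCentered P A b) (varProfile P A) (2 * b) := by
  have hmt : ∀ i j, Measurable fun ω => trunc b (A ω i j) := fun i j =>
    (measurable_trunc b).comp (hmeas i j)
  have hint : ∀ i j, Integrable (fun ω => trunc b (A ω i j)) P := fun i j =>
    Integrable.of_bound (hmt i j).aestronglyMeasurable b
      (Eventually.of_forall fun ω => abs_trunc_le hb.le _)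
  have hmean : ∀ i j, |truncMean P A b i j| ≤ b := by
    intro i j
    have := norm_integral_le_of_norm_le_const (μ := P) (f := fun ω => trunc b (A ω i j)) (C := b)
      (Eventually.of_forall fun ω => abs_trunc_le hb.le _)
    simpa [truncMean] using this
  have hint2 : ∀ i j, Integrable (fun ω => trunc b (A ω i j) ^ 2) P := fun i j =>
    Integrable.of_bound ((hmt i j).pow_const 2).aestronglyMeasurable (b ^ 2)
      (Eventually.of_forall fun ω => by
        rw [Real.norm_eq_abs, abs_pow]
        exact pow_le_pow_left₀ (abs_nonneg _) (abs_trunc_le hb.le _) 2)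
  refine ⟨fun i j => (hmt i j).sub_const _, fun ω => ?_, ?_, by positivity, fun ω i j => ?_,
    fun i j => ?_, fun i j => ?_⟩
  · refine Matrix.IsSymm.ext fun i j => ?_
    have : ∀ ω, A ω j i = A ω i j := fun ω => (hsymm ω).apply i j
    simp [truncCentered, truncMean, this]
  · exact hindep.comp (fun p x => trunc b x - truncMean P A b p.1.1 p.1.2)
      fun p => (measurable_trunc b).sub_const _
  · calc |trunc b (A ω i j) - truncMean P A b i j| ≤ |trunc b (A ω i j)| + |truncMean P A b i j| :=
          abs_sub _ _
      _ ≤ 2 * b := by linarith [abs_trunc_le hb.le (A ω i j), hmean i j]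
  · simp only [truncCentered, Matrix.of_apply]
    rw [integral_sub (hint i j) (integrable_const _)]
    simp [truncMean]
  · set m := truncMean P A b i j with hm
    have h1 : ∫ ω, truncCentered P A b ω i j ^ 2 ∂P =
        ∫ ω, trunc b (A ω i j) ^ 2 ∂P - m ^ 2 := by
      have h2 : ∀ ω, truncCentered P A b ω i j ^ 2 =
          (trunc b (A ω i j) ^ 2 - 2 * m * trunc b (A ω i j)) + m ^ 2 := by
        intro ω
        simp only [truncCentered, Matrix.of_apply, ← hm]
        ring
      simp only [h2]
      have e1 : Integrable (fun ω => trunc b (A ω i j) ^ 2 - 2 * m * trunc b (A ω i j)) P :=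
        (hint2 i j).sub ((hint i j).const_mul _)
      rw [integral_add e1 (integrable_const _), integral_sub (hint2 i j) ((hint i j).const_mul _), integral_const_mul]
      have h3 : ∫ ω, trunc b (A ω i j) ∂P = m := rfl
      rw [h3]
      simp
      ring
    rw [h1, varProfile]
    have h4 : ∫ ω, trunc b (A ω i j) ^ 2 ∂P ≤ ∫ ω, |A ω i j| ^ 2 ∂P :=
      integral_mono (hint2 i j) (hsq i j) fun ω => trunc_sq_le _ _
    linarith [sq_nonneg m]

/-- Since the entry is centred, the mean of its truncation is minus the mean of the cut-off part,
where $|x|\le|x|^4/b^3$. -/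
theorem abs_truncMean_le {K : ℝ} (hmeas : ∀ i j, Measurable fun ω => A ω i j)
    (hint : ∀ i j, Integrable (fun ω => A ω i j) P)
    (hfour : ∀ i j, Integrable (fun ω => |A ω i j| ^ 4) P)
    (hmean : ∀ i j, ∫ ω, A ω i j ∂P = 0) (hK : ∀ i j, ∫ ω, |A ω i j| ^ 4 ∂P ≤ K) (hb : 0 < b)
    (i j : Fin N) : |truncMean P A b i j| ≤ K / b ^ 3 := by
  have hit : Integrable (fun ω => trunc b (A ω i j)) P :=
    Integrable.of_bound ((measurable_trunc b).comp (hmeas i j)).aestronglyMeasurable b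
      (Eventually.of_forall fun ω => abs_trunc_le hb.le _)
  have h1 : truncMean P A b i j = -∫ ω, (A ω i j - trunc b (A ω i j)) ∂P := by
    rw [integral_sub (hint i j) hit, hmean i j]
    simp [truncMean]
  rw [h1, abs_neg, ← Real.norm_eq_abs]
  calc ‖∫ ω, (A ω i j - trunc b (A ω i j)) ∂P‖ ≤ ∫ ω, |A ω i j| ^ 4 / b ^ 3 ∂P :=
        norm_integral_le_of_norm_le ((hfour i j).div_const _)
          (Eventually.of_forall fun ω => abs_sub_trunc_le hb _)
    _ = (∫ ω, |A ω i j| ^ 4 ∂P) / b ^ 3 := integral_div _ _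
    _ ≤ K / b ^ 3 := by gcongr; exact hK i j

/-- Two large entries in the same row are unlikely. -/
theorem measure_two_large_entries_le {K : ℝ}
    (hsymm : ∀ ω, (A ω).IsSymm)
    (hindep : iIndepFun (fun (p : {p : Fin N × Fin N // p.1 ≤ p.2}) ω => A ω p.1.1 p.1.2) P)
    (hfour : ∀ i j, Integrable (fun ω => |A ω i j| ^ 4) P)
    (hK : ∀ i j, ∫ ω, |A ω i j| ^ 4 ∂P ≤ K) (hb : 0 < b) :
    P.real {ω | ∃ i j j', j ≠ j' ∧ b < |A ω i j| ∧ b < |A ω i j'|} ≤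
      (N : ℝ) ^ 3 * (K / b ^ 4) ^ 2 := by
  have hone : ∀ i j, P.real {ω | b < |A ω i j|} ≤ K / b ^ 4 := by
    intro i j
    have h1 := mul_meas_ge_le_integral_of_nonneg (μ := P) (f := fun ω => |A ω i j| ^ 4)
      (Eventually.of_forall fun ω => by positivity) (hfour i j) (b ^ 4)
    rw [le_div_iff₀' (by positivity)]
    refine le_trans (mul_le_mul_of_nonneg_left (measureReal_mono fun ω hω => ?_) (by positivity))
      (h1.trans (hK i j))
    exact pow_le_pow_left₀ hb.le (le_of_lt hω) 4
  have htwo : ∀ i j j', P.real {ω | j ≠ j' ∧ b < |A ω i j| ∧ b < |A ω i j'|} ≤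
      (K / b ^ 4) ^ 2 := by
    intro i j j'
    by_cases hjj : j = j'
    · simp only [hjj, ne_eq, not_true_eq_false, false_and]
      simpa using sq_nonneg (K / b ^ 4)
    -- Distinct positions in one row are distinct unordered pairs, even if one lies on the diagonal,
    -- so their entries are independent.
    have hne : sortedPair i j ≠ sortedPair i j' := by
      intro h
      rcases sortedPair_eq_iff.1 h with ⟨-, h2⟩ | ⟨h1, h2⟩
      · exact hjj h2
      · exact hjj (h2.trans h1)
    have hset : MeasurableSet {x : ℝ | b < |x|} :=
      measurableSet_lt measurable_const measurable_id.abs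
    have hind := (hindep.indepFun hne).measure_inter_preimage_eq_mul _ _ hset hset
    have h1 : ∀ j, (fun ω => A ω (sortedPair i j).1.1 (sortedPair i j).1.2) ⁻¹' {x : ℝ | b < |x|} =
        {ω | b < |A ω i j|} := by
      intro j
      ext ω
      simp only [Set.mem_preimage, Set.mem_ofPred_eq, apply_sortedPair (hsymm ω)]
    rw [h1, h1] at hind
    have h2 : {ω | j ≠ j' ∧ b < |A ω i j| ∧ b < |A ω i j'|} =
        {ω | b < |A ω i j|} ∩ {ω | b < |A ω i j'|} := by
      ext ω
      simp [hjj]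
    rw [h2, measureReal_def, hind, ENNReal.toReal_mul, sq]
    exact mul_le_mul (hone i j) (hone i j') measureReal_nonneg
      (measureReal_nonneg.trans (hone i j))
  have hunion : {ω | ∃ i j j', j ≠ j' ∧ b < |A ω i j| ∧ b < |A ω i j'|} =
      ⋃ q : Fin N × Fin N × Fin N,
        {ω | q.2.1 ≠ q.2.2 ∧ b < |A ω q.1 q.2.1| ∧ b < |A ω q.1 q.2.2|} := by
    ext ω
    simp [Prod.exists]
  rw [hunion]
  calc _ ≤ ∑ q : Fin N × Fin N × Fin N,
        P.real {ω | q.2.1 ≠ q.2.2 ∧ b < |A ω q.1 q.2.1| ∧ b < |A ω q.1 q.2.2|} :=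
        measureReal_iUnion_fintype_le _
    _ ≤ ∑ _q : Fin N × Fin N × Fin N, (K / b ^ 4) ^ 2 := Finset.sum_le_sum fun q _ => htwo _ _ _
    _ = (N : ℝ) ^ 3 * (K / b ^ 4) ^ 2 := by
        rw [Finset.sum_const, Finset.card_univ]
        simp only [Fintype.card_prod, Fintype.card_fin, nsmul_eq_mul]
        push_cast
        ring

theorem opNorm_truncTail_le {Ω' : Type*} {A : Ω' → Matrix (Fin N) (Fin N) ℝ}
    (hsymm : ∀ ω, (A ω).IsSymm) {c : ℝ} (hc : 0 ≤ c) {ω : Ω'}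
    (hle : ∀ i j, |A ω i j| ≤ c)
    (hrow : ¬ ∃ i j j', j ≠ j' ∧ b < |A ω i j| ∧ b < |A ω i j'|) :
    opNorm (truncTail A b ω) ≤ c := by
  refine opNorm_le_of_sparse _ hc (fun i j => (abs_sub_trunc_le_abs _ _).trans (hle i j)) ?_ ?_
  · refine Matrix.IsSymm.ext fun i j => ?_
    have : A ω j i = A ω i j := (hsymm ω).apply i j
    simp [truncTail, this]
  · intro i j j' h h'
    by_contra hne
    exact hrow ⟨i, j, j', hne, lt_abs_of_sub_trunc_ne_zero h, lt_abs_of_sub_trunc_ne_zero h'⟩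

end Truncation

/-! ### Asymptotics for the truncation level $N^{7/16}$. -/

section Asymptotics

/-- The number of exploration codes is negligible for walks of logarithmic length. -/
theorem eventually_code_bound {D c : ℝ} (hc : 0 < c) :
    ∀ᶠ N : ℕ in atTop, ∀ k : ℕ, (k : ℝ) ≤ D * Real.log N →
      (2 * (k : ℝ) * (k + 1) + 1) ^ 4 * (2 * (N : ℝ) ^ (7 / 16 : ℝ)) ^ 2 ≤ N * c := by
  set E : ℝ := (2 * (|D| + 1)) ^ 8 * 4 with hE
  have hE0 : 0 < E := by positivity
  -- The code factor is of order at most $\log^8 N$ and $b^2=N^{7/8}$, which leaves room $N^{1/8}$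
  -- below $N$.
  have h1 := (isLittleO_log_rpow_rpow_atTop (8 : ℝ) (show (0 : ℝ) < 1 / 8 by norm_num)).bound
    (div_pos hc hE0)
  have h2 := tendsto_natCast_atTop_atTop (R := ℝ) |>.eventually h1
  have h3 : ∀ᶠ N : ℕ in atTop, 1 ≤ Real.log N :=
    (Real.tendsto_log_atTop.comp tendsto_natCast_atTop_atTop).eventually_ge_atTop 1
  filter_upwards [h2, h3, eventually_gt_atTop 0] with N hN hlog hpos k hk
  have hN0 : (0 : ℝ) < N := Nat.cast_pos.2 hpos
  have hlog0 : 0 ≤ Real.log N := zero_le_one.trans hlog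
  rw [Real.norm_of_nonneg (by positivity), Real.norm_of_nonneg (by positivity)] at hN
  have hlog8 : Real.log N ^ (8 : ℝ) = Real.log N ^ 8 := by
    rw [← Real.rpow_natCast]
    norm_num
  rw [hlog8] at hN
  have hb2 : ((N : ℝ) ^ (7 / 16 : ℝ)) ^ 2 = (N : ℝ) ^ (7 / 8 : ℝ) := by
    rw [← Real.rpow_natCast, ← Real.rpow_mul hN0.le]
    norm_num
  have hprod : (N : ℝ) ^ (1 / 8 : ℝ) * (N : ℝ) ^ (7 / 8 : ℝ) = N := by
    rw [← Real.rpow_add hN0]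
    norm_num
  have hk0 : (0 : ℝ) ≤ k := Nat.cast_nonneg k
  have hk1 : (k : ℝ) + 1 ≤ (|D| + 1) * Real.log N := by
    have : D * Real.log N ≤ |D| * Real.log N :=
      mul_le_mul_of_nonneg_right (le_abs_self D) hlog0
    linarith
  have hcode : (2 * (k : ℝ) * (k + 1) + 1) ^ 4 ≤ (2 * (|D| + 1)) ^ 8 * Real.log N ^ 8 := by
    calc (2 * (k : ℝ) * (k + 1) + 1) ^ 4 ≤ ((2 * ((k : ℝ) + 1)) ^ 2) ^ 4 := by
          refine pow_le_pow_left₀ (by positivity) ?_ 4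
          nlinarith
      _ = (2 * ((k : ℝ) + 1)) ^ 8 := by rw [← pow_mul]
      _ ≤ (2 * ((|D| + 1) * Real.log N)) ^ 8 := by gcongr
      _ = (2 * (|D| + 1)) ^ 8 * Real.log N ^ 8 := by rw [← mul_pow]; ring
  calc (2 * (k : ℝ) * (k + 1) + 1) ^ 4 * (2 * (N : ℝ) ^ (7 / 16 : ℝ)) ^ 2
      ≤ ((2 * (|D| + 1)) ^ 8 * Real.log N ^ 8) * (2 * (N : ℝ) ^ (7 / 16 : ℝ)) ^ 2 := by gcongr
    _ = E * Real.log N ^ 8 * (N : ℝ) ^ (7 / 8 : ℝ) := by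
        rw [mul_pow 2 ((N : ℝ) ^ (7 / 16 : ℝ)), hb2, hE]
        ring
    _ ≤ E * (c / E * (N : ℝ) ^ (1 / 8 : ℝ)) * (N : ℝ) ^ (7 / 8 : ℝ) := by gcongr
    _ = c * ((N : ℝ) ^ (1 / 8 : ℝ) * (N : ℝ) ^ (7 / 8 : ℝ)) := by
        field_simp
    _ = N * c := by rw [hprod, mul_comm]

theorem tendsto_mul_rpow_neg (K : ℝ) {a : ℝ} (ha : 0 < a) :
    Tendsto (fun N : ℕ => K * (N : ℝ) ^ (-a)) atTop (𝓝 0) := by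
  have := ((tendsto_rpow_neg_atTop ha).comp tendsto_natCast_atTop_atTop).const_mul K
  simpa using this

/-- The mean of the truncated matrix is negligible. -/
theorem eventually_mean_bound (K : ℝ) {δ : ℝ} (hδ : 0 < δ) :
    ∀ᶠ N : ℕ in atTop, (N : ℝ) * (K / ((N : ℝ) ^ (7 / 16 : ℝ)) ^ 3) ≤ δ * √(N : ℝ) := by
  have h := (tendsto_mul_rpow_neg K (show (0 : ℝ) < 13 / 16 by norm_num)).eventually_le_const hδ
  filter_upwards [h, eventually_gt_atTop 0] with N hN hpos
  have hN0 : (0 : ℝ) < N := Nat.cast_pos.2 hpos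
  have e1 : (N : ℝ) * (K / ((N : ℝ) ^ (7 / 16 : ℝ)) ^ 3) =
      K * (N : ℝ) ^ (-(13 / 16) : ℝ) * (N : ℝ) ^ (1 / 2 : ℝ) := by
    rw [← Real.rpow_natCast, ← Real.rpow_mul hN0.le, div_eq_mul_inv, ← Real.rpow_neg hN0.le]
    nth_rewrite 1 [← Real.rpow_one (N : ℝ)]
    rw [mul_left_comm, ← Real.rpow_add hN0, mul_assoc, ← Real.rpow_add hN0]
    norm_num
  rw [e1, ← Real.sqrt_eq_rpow]
  exact mul_le_mul_of_nonneg_right hN (Real.sqrt_nonneg _)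

/-- The exponent is $3-8\cdot\frac7{16}=-\frac12$. A level $N^a$ needs $a>\frac38$ here and
$a<\frac12$ in `eventually_code_bound`; $\frac7{16}$ is the midpoint. -/
theorem tendsto_two_large_entries_bound (K : ℝ) :
    Tendsto (fun N : ℕ => (N : ℝ) ^ 3 * (K / ((N : ℝ) ^ (7 / 16 : ℝ)) ^ 4) ^ 2) atTop (𝓝 0) := by
  refine (tendsto_mul_rpow_neg (K ^ 2) (show (0 : ℝ) < 1 / 2 by norm_num)).congr' ?_
  filter_upwards [eventually_gt_atTop 0] with N hpos
  have hN0 : (0 : ℝ) < N := Nat.cast_pos.2 hpos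
  have e1 : ((N : ℝ) ^ (7 / 16 : ℝ)) ^ 4 = (N : ℝ) ^ (7 / 4 : ℝ) := by
    rw [← Real.rpow_natCast, ← Real.rpow_mul hN0.le]
    norm_num
  have e2 : ((N : ℝ) ^ (7 / 4 : ℝ)) ^ 2 = (N : ℝ) ^ (7 / 2 : ℝ) := by
    rw [← Real.rpow_natCast, ← Real.rpow_mul hN0.le]
    norm_num
  have e3 : (N : ℝ) ^ 3 = (N : ℝ) ^ (3 : ℝ) := by
    rw [← Real.rpow_natCast]
    norm_num
  rw [div_pow, e1, e2, e3, div_eq_mul_inv (K ^ 2), ← Real.rpow_neg hN0.le, mul_left_comm,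
    ← Real.rpow_add hN0]
  norm_num

end Asymptotics

/-! ### Choice of the moment, and conclusion. -/

section Main

variable {Ω : Type*} [MeasurableSpace Ω] {P : Measure Ω} [IsProbabilityMeasure P]

/-- The tail bound for the centered truncated matrix. -/
theorem eventually_truncCentered_tail {A : (N : ℕ) → Ω → Matrix (Fin N) (Fin N) ℝ} {R η : ℝ}
    (hR : 0 < R) (hη : 0 < η) (hS : ConditionSigma P A R)
    (hX : ∀ N : ℕ, 0 < N → IsBoundedSymm P
      (truncCentered P (A N) ((N : ℝ) ^ (7 / 16 : ℝ))) (varProfile P (A N))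
      (2 * (N : ℝ) ^ (7 / 16 : ℝ))) :
    ∃ C : ℝ, ∀ᶠ N : ℕ in atTop,
      P.real {ω | R * (1 + η) * √(N : ℝ) ≤
        opNorm (truncCentered P (A N) ((N : ℝ) ^ (7 / 16 : ℝ)) ω)} ≤ C / N := by
  set lam := Real.log (1 + η) with hlam
  have hlam0 : 0 < lam := Real.log_pos (by linarith)
  -- The summand 1 absorbs the rounding in `k` below, as soon as `1 ≤ Real.log N`.
  obtain ⟨C₂, hC₂, N₀, -, hT⟩ := hS (1 / lam + 1) (by positivity)
  -- The maximum with 1 covers the tree without edges.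
  set C := max C₂ 1 with hC
  have hC0 : 0 ≤ C := zero_le_one.trans (le_max_right _ _)
  have hlog : ∀ᶠ N : ℕ in atTop, 1 ≤ Real.log N :=
    (Real.tendsto_log_atTop.comp tendsto_natCast_atTop_atTop).eventually_ge_atTop 1
  refine ⟨2 * C, ?_⟩
  filter_upwards [eventually_code_bound (D := 1 / lam + 1) (show 0 < R ^ 2 / 2 by positivity), hlog,
    eventually_gt_atTop 0, eventually_ge_atTop N₀] with N hcode hlog1 hpos hN₀
  have hN0 : (0 : ℝ) < N := Nat.cast_pos.2 hpos
  -- This makes $(1+\eta)^k\ge N$, so the factor $(1+\eta)^{-2k}\le N^{-2}$ outweighs the dimension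
  -- factor $N$ of the trace.
  set k := ⌈Real.log N / lam⌉₊ with hk
  have hk1 : Real.log N ≤ k * lam := (div_le_iff₀ hlam0).1 (Nat.le_ceil _)
  have hk2 : (k : ℝ) ≤ (1 / lam + 1) * Real.log N := by
    have := (Nat.ceil_lt_add_one (show 0 ≤ Real.log N / lam by positivity)).le
    calc (k : ℝ) ≤ Real.log N / lam + 1 := this
      _ ≤ (1 / lam + 1) * Real.log N := by rw [add_mul, one_div_mul_eq_div]; linarith
  have htree : ∀ n ≤ k, treeSum (varProfile P (A N)) n ≤
      C * (N : ℝ) ^ (n + 1) * R ^ (2 * n) := by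
    intro n hn
    rcases Nat.eq_zero_or_pos n with rfl | hn0
    · refine (treeSum_zero_le _).trans ?_
      have : 1 * (N : ℝ) ≤ C * N := mul_le_mul_of_nonneg_right (le_max_right _ _) hN0.le
      simpa using this
    · refine (hT N n hN₀ hn0 ?_).trans ?_
      · exact le_trans (Nat.cast_le.2 hn) hk2
      · have := le_max_left C₂ 1
        gcongr
  have hbound := (hX N hpos).measure_opNorm_ge_le (ρ := R * (1 + η)) hpos hC0 (by positivity) htree
    ((hcode k hk2).trans (le_of_eq (by ring)))
  refine hbound.trans ?_
  have hpow : (N : ℝ) ≤ (1 + η) ^ k := by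
    rw [← Real.log_le_log_iff hN0 (by positivity), Real.log_pow]
    exact hk1
  have e1 : R / (R * (1 + η)) = (1 + η)⁻¹ := by
    field_simp
  rw [e1, inv_pow, mul_comm 2 k, pow_mul, ← div_eq_mul_inv,
    div_le_div_iff₀ (by positivity) hN0]
  have h2 : (N : ℝ) ^ 2 ≤ ((1 + η) ^ k) ^ 2 := pow_le_pow_left₀ hN0.le hpow 2
  calc 2 * C * N * N = 2 * C * (N : ℝ) ^ 2 := by ring
    _ ≤ 2 * C * ((1 + η) ^ k) ^ 2 := by gcongr

end Main

theorem mainTheorem6 {Ω : Type*} [MeasurableSpace Ω] (P : Measure Ω) [IsProbabilityMeasure P]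
    (A : (N : ℕ) → Ω → Matrix (Fin N) (Fin N) ℝ) (R : ℝ) (hR : 0 < R)
    (hA : IsSymmRandomMatrixSeq P A) (hM : MomentAssumption P A) (hS : ConditionSigma P A R) :
    ∀ ε : ℝ, 0 < ε →
      Tendsto (fun N : ℕ => P.real {ω | R * (1 + ε) ≤ opNorm (A N ω) / √(N : ℝ)})
        atTop (𝓝 0) := by
  intro ε hε
  obtain ⟨K, hK⟩ := hM.fourth_moment
  have hint4 : ∀ N i j, Integrable (fun ω => |A N ω i j| ^ 4) P := fun N i j => by
    simpa using (hM.memLp N i j).integrable_norm_pow (p := 4) (by norm_num)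
  have hint2 : ∀ N i j, Integrable (fun ω => |A N ω i j| ^ 2) P := fun N i j => by
    simpa using ((hM.memLp N i j).mono_exponent (p := 2) (by norm_num)).integrable_norm_pow
      (p := 2) (by norm_num)
  have hint1 : ∀ N i j, Integrable (fun ω => A N ω i j) P := fun N i j =>
    (hM.memLp N i j).integrable (by norm_num)
  set b : ℕ → ℝ := fun N => (N : ℝ) ^ (7 / 16 : ℝ) with hb
  have hb0 : ∀ N : ℕ, 0 < N → 0 < b N := fun N hN => Real.rpow_pos_of_pos (Nat.cast_pos.2 hN) _
  have hX : ∀ N : ℕ, 0 < N →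
      IsBoundedSymm P (truncCentered P (A N) (b N)) (varProfile P (A N)) (2 * b N) := fun N hN =>
    isBoundedSymm_truncCentered (hA.measurable N) (hA.isSymm N) (hA.indep N) (hint2 N) (hb0 N hN)
  obtain ⟨C, hC⟩ := eventually_truncCentered_tail hR (half_pos hε) hS hX
  -- Half of the margin `R * ε` goes to the centred truncation and a quarter each to the mean and
  -- the cut-off part.
  set δ := R * ε / 4 with hδ
  have hδ0 : 0 < δ := by positivity
  have hlim : Tendsto (fun N : ℕ => C / N +
      (N : ℝ) ^ 3 * (K / (b N) ^ 4) ^ 2 +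
      ∑ i : Fin N, ∑ j : Fin N, P.real {ω | δ * √(N : ℝ) ≤ |A N ω i j|}) atTop (𝓝 0) := by
    simpa using ((tendsto_const_div_atTop_nhds_zero_nat C).add
      (tendsto_two_large_entries_bound K)).add (hM.tail δ hδ0)
  refine tendsto_of_tendsto_of_tendsto_of_le_of_le' tendsto_const_nhds hlim
    (Eventually.of_forall fun N => measureReal_nonneg) ?_
  filter_upwards [hC, eventually_mean_bound K hδ0, eventually_gt_atTop 0] with N hCN hmean hpos
  have hN0 : (0 : ℝ) < N := Nat.cast_pos.2 hpos
  have hsqrt : 0 < √(N : ℝ) := Real.sqrt_pos.2 hN0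
  set S₁ : Set Ω := {ω | R * (1 + ε / 2) * √(N : ℝ) ≤ opNorm (truncCentered P (A N) (b N) ω)}
    with hS₁
  set S₂ : Set Ω := {ω | ∃ i j j', j ≠ j' ∧ b N < |A N ω i j| ∧ b N < |A N ω i j'|} with hS₂
  set S₃ : Set Ω := ⋃ p : Fin N × Fin N, {ω | δ * √(N : ℝ) ≤ |A N ω p.1 p.2|} with hS₃
  have hsub : {ω | R * (1 + ε) ≤ opNorm (A N ω) / √(N : ℝ)} ⊆ S₁ ∪ S₂ ∪ S₃ := by
    intro ω hω
    by_contra hno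
    simp only [Set.mem_union, not_or] at hno
    obtain ⟨⟨h1, h2⟩, h3⟩ := hno
    have hle : ∀ i j, |A N ω i j| ≤ δ * √(N : ℝ) := by
      intro i j
      by_contra hlt
      exact h3 (Set.mem_iUnion.2 ⟨(i, j), (not_le.1 hlt).le⟩)
    have hZ : opNorm (truncTail (A N) (b N) ω) ≤ δ * √(N : ℝ) :=
      opNorm_truncTail_le (hA.isSymm N) (by positivity) hle h2
    have hY : opNorm (truncMean P (A N) (b N)) ≤ δ * √(N : ℝ) := by
      have hKb := abs_truncMean_le (hA.measurable N) (hint1 N) (hint4 N) (hM.mean_zero N) (hK N)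
        (hb0 N hpos)
      have h0 : 0 ≤ K / b N ^ 3 := (abs_nonneg _).trans (hKb ⟨0, hpos⟩ ⟨0, hpos⟩)
      exact (opNorm_le_mul_of_abs_le _ h0 hKb).trans hmean
    have h1' : opNorm (truncCentered P (A N) (b N) ω) < R * (1 + ε / 2) * √(N : ℝ) := not_le.1 h1
    have hω' : R * (1 + ε) * √(N : ℝ) ≤ opNorm (A N ω) := (le_div_iff₀ hsqrt).1 hω
    rw [truncation_eq P (A N) (b N) ω] at hω'
    have h4 := opNorm_add_le (truncCentered P (A N) (b N) ω + truncMean P (A N) (b N))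
      (truncTail (A N) (b N) ω)
    have h5 := opNorm_add_le (truncCentered P (A N) (b N) ω) (truncMean P (A N) (b N))
    have h6 : R * (1 + ε) * √(N : ℝ) =
        R * (1 + ε / 2) * √(N : ℝ) + δ * √(N : ℝ) + δ * √(N : ℝ) := by
      rw [hδ]
      ring
    linarith
  calc P.real {ω | R * (1 + ε) ≤ opNorm (A N ω) / √(N : ℝ)}
      ≤ P.real (S₁ ∪ S₂ ∪ S₃) := measureReal_mono hsub
    _ ≤ P.real S₁ + P.real S₂ + P.real S₃ :=
        (measureReal_union_le _ _).trans (add_le_add_left (measureReal_union_le _ _) _)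
    _ ≤ _ := by
        refine add_le_add (add_le_add hCN ?_) ?_
        · exact measure_two_large_entries_le (hA.isSymm N) (hA.indep N) (hint4 N) (hK N)
            (hb0 N hpos)
        · refine (measureReal_iUnion_fintype_le _).trans (le_of_eq ?_)
          rw [Fintype.sum_prod_type]
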